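/- Let $p$ be a prime, let $\mathcal F$ be a saturated fusion system on a finite $p$-group $S$, and let $P\le S$ be strongly $\mathcal F$-closed, i.e. $x\varphi\in P$ for all $x\in P$ and all $\varphi\in \mathrm{Hom}_{\mathcal F}(\langle x\rangle,S)$. (Here saturated means that $\mathrm{Aut}_S(S)\in \mathrm{Syl}_p(\mathrm{Aut}_{\mathcal F}(S))$ and that every $\varphi\in\mathrm{Hom}_{\mathcal F}(Q,S)$ with $Q\varphi$ fully normalized extends to a morphism $N_\varphi\to S$ of $\mathcal F$, where $N_\varphi=\{x\in N_S(Q): \exists y\in N_S(Q\varphi),\ \varphi^{-1}c_x\varphi=c_y \text{ on } Q\varphi\}$. A subgroup $Q\le S$ is fully normalized if $|N_S(Q)|\ge|N_S(R)|$ for every $\mathcal F$-conjugate $R$ of $Q$.) **Definitions.** Let $G$ be a finite group, let $T\in \mathrm{Syl}_p(G)$, and let $1\ne D\le T$ be strongly closed in $T$ with respect to $G$ (if $x\in D$, $g\in G$ and $x^g\in T$, then $x^g\in D$). A proper subgroup $H$ of $G$ is *strongly $D$-embedded* in $G$ if $D^x\le H$ for some $x\in G$, and for every $g\in G\setminus H$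 the subgroup $H\cap H^g$ contains no $G$-conjugate of any nontrivial subgroup of $D$. A proper subgroup $Q$ of $P$ is *$\mathcal F$-essential with respect to $P$* if (i) $C_P(Q\psi)\le Q\psi$ for all $\psi\in\mathrm{Hom}_{\mathcal F}(Q,P)$; (ii) $Q$ is fully normalized; (iii) $\mathrm{Out}_{\mathcal F}(Q)=\mathrm{Aut}_{\mathcal F}(Q)/\mathrm{Inn}(Q)$ has a strongly $\mathrm{Out}_P(Q)$-embedded subgroup, where $\mathrm{Out}_P(Q)$ is the image in $\mathrm{Out}_{\mathcal F}(Q)$ of the group $\mathrm{Aut}_P(Q)$ of automorphisms of $Q$ induced by conjugation by elements of $N_P(Q)$. Finally, $P\unlhd\mathcal F$ means that $\mathcal F=N_{\mathcal F}(P)$: $P\unlhd S$, and every morphism $Q\to R$ of $\mathcal F$ extends to a morphism $PQ\to PR$ of $\mathcal F$ which maps $P$ onto $P$. **Theorem A.** Let $Q,R\le P$ and let $\psi:Q\to R$ be an $\mathcal F$-isomorphism. Then there exist $n\geq 0$ and (a) a sequence $Q=Q_0,Q_1,\dots,Q_n=R$ of isomorphic subgroups of $P$, (b) a sequence $S_1,\dots,S_n$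 of subgroups of $P$, where each $S_i$ is $\mathcal F$-essential with respect to $P$ or $S_i=P$, such that $Q_{i-1},Q_i\le S_i$ for $i=1,\dots,n$, (c) automorphisms $\psi_i\in\mathrm{Aut}_{\mathcal F}(S_i)$ with $\psi_i(Q_{i-1})=Q_i$ for $i=1,\dots,n$, such that $\psi$ is the composite of $\psi_1|_{Q_0}$, then $\psi_2|_{Q_1}$, ..., then $\psi_n|_{Q_{n-1}}$. Moreover, $P\unlhd\mathcal F$ if and only if there is no $\mathcal F$-essential subgroup with respect to $P$. -/

import Mathlib

namespace Fusion

/-! ### Strongly embedded subgroups relative to a strongly closed subgroup -/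

/-- The conjugate `H ^ g = g⁻¹ H g`. -/
def conjSubgroup {G : Type*} [Group G] (H : Subgroup G) (g : G) : Subgroup G :=
  H.map (MulAut.conj g⁻¹).toMonoidHom

/-- `D ≤ T ≤ G` is strongly closed in `T` with respect to `G`. -/
def StronglyClosedIn {G : Type*} [Group G] (D T : Subgroup G) : Prop :=
  D ≤ T ∧ ∀ x ∈ D, ∀ g : G, g⁻¹ * x * g ∈ T → g⁻¹ * x * g ∈ D

/-- `H` is a strongly `D`-embedded subgroup of `G`. The first two clauses are the conditions on `D`
under which the notion is defined: `D > 1`, and `D` is strongly closed, with respect to `G`, in some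
Sylow `p`-subgroup of `G`. -/
structure IsStronglyEmbedded (p : ℕ) {G : Type*} [Group G] (D H : Subgroup G) : Prop where
  nontrivial : D ≠ ⊥
  stronglyClosed : ∃ T : Sylow p G, StronglyClosedIn D (T : Subgroup G)
  proper : H ≠ ⊤
  conj_le : ∃ x : G, conjSubgroup D x ≤ H
  not_conj_le : ∀ g : G, g ∉ H → ∀ U : Subgroup G, U ≤ D → U ≠ ⊥ →
    ∀ y : G, ¬ conjSubgroup U y ≤ H ⊓ conjSubgroup H g

/-! ### Fusion systems -/

/-- A fusion system on `S`: a category whose objects are the subgroups of `S`, whose morphisms are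
injective group homomorphisms, which contains all homomorphisms induced by conjugation in `S`
(in particular identities and inclusions), and in which every morphism `φ : Q → R` factors as an
isomorphism of the category `Q → φ(Q)` followed by the inclusion `φ(Q) → R`.  The last requirement is
split into `corestrict_mem` (the codomain of a morphism may be changed to any subgroup that
contains the image) and `symm_mem` (a bijective morphism has its inverse in the category). -/
structure FusionSystem (S : Type*) [Group S] where
  /-- The set of morphisms from `Q` to `R`. -/
  Hom : ∀ Q R : Subgroup S, Set (Q →* R)
  injective_of_mem : ∀ {Q R : Subgroup S} {φ : Q →* R}, φ ∈ Hom Q R → Function.Injective φ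
  conj_mem : ∀ {Q R : Subgroup S} (φ : Q →* R) (g : S),
    (∀ x : Q, (φ x : S) = g * x * g⁻¹) → φ ∈ Hom Q R
  comp_mem : ∀ {Q R T : Subgroup S} {φ : Q →* R} {ψ : R →* T},
    φ ∈ Hom Q R → ψ ∈ Hom R T → ψ.comp φ ∈ Hom Q T
  corestrict_mem : ∀ {Q R T : Subgroup S} {φ : Q →* R} (ψ : Q →* T),
    φ ∈ Hom Q R → (∀ x : Q, (ψ x : S) = φ x) → ψ ∈ Hom Q T
  symm_mem : ∀ {Q R : Subgroup S} (e : Q ≃* R),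
    e.toMonoidHom ∈ Hom Q R → e.symm.toMonoidHom ∈ Hom R Q

section

variable {S : Type*} [Group S]

/-- The image of a homomorphism `φ : Q → R` between subgroups of `S`, as a subgroup of `S`. -/
def image {Q R : Subgroup S} (φ : Q →* R) : Subgroup S := φ.range.map R.subtype

theorem coe_mem_image {Q R : Subgroup S} (φ : Q →* R) (u : Q) : (φ u : S) ∈ image φ :=
  ⟨φ u, ⟨u, rfl⟩, rfl⟩

/-- `Aut_P(Q)`: the automorphisms of `Q` induced by conjugation by elements of `N_P(Q)`. -/
def autBy (P Q : Subgroup S) : Subgroup (MulAut Q) :=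
  (P.subgroupOf (Subgroup.normalizer (Q : Set S))).map Q.normalizerMonoidHom

/-- `N_φ`: the subgroup of all `x ∈ N_S(Q)` for which there is `y ∈ N_S(φ(Q))` such that conjugation
by `x` on `Q` is transported by `φ` to conjugation by `y` on `φ(Q)`. -/
def extender {Q R : Subgroup S} (φ : Q →* R) : Subgroup S where
  carrier := {x | x ∈ Subgroup.normalizer (Q : Set S) ∧
    ∃ y ∈ Subgroup.normalizer (image φ : Set S),
      ∀ u v : Q, (v : S) = x * u * x⁻¹ → (φ v : S) = y * φ u * y⁻¹}
  one_mem' := ⟨one_mem _, 1, one_mem _, fun u v h => by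
    have : v = u := Subtype.ext (by simpa using h)
    simp [this]⟩
  mul_mem' := by
    rintro a b ⟨ha, y, hy, h⟩ ⟨hb, z, hz, k⟩
    refine ⟨mul_mem ha hb, y * z, mul_mem hy hz, fun u v huv => ?_⟩
    have hw : b * u * b⁻¹ ∈ Q := (Subgroup.mem_normalizer_iff.1 hb _).1 u.2
    rw [h ⟨_, hw⟩ v (by simp [huv, mul_assoc]), k u ⟨_, hw⟩ rfl]
    simp [mul_assoc]
  inv_mem' := by
    rintro a ⟨ha, y, hy, h⟩
    refine ⟨inv_mem ha, y⁻¹, inv_mem hy, fun u v huv => ?_⟩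
    rw [h v u (by simp [huv, mul_assoc])]
    simp [mul_assoc]

theorem le_extender {Q R : Subgroup S} (φ : Q →* R) : Q ≤ extender φ := fun x hx =>
  ⟨Subgroup.le_normalizer hx, φ ⟨x, hx⟩, Subgroup.le_normalizer (coe_mem_image φ _),
    fun u v h => by
      have : v = ⟨x, hx⟩ * u * ⟨x, hx⟩⁻¹ := Subtype.ext (by simpa using h)
      simp [this]⟩

namespace FusionSystem

variable (F : FusionSystem S)

/-- `Aut_F(Q)`, the group of automorphisms of `Q` in the category `F`. -/
def Aut (Q : Subgroup S) : Subgroup (MulAut Q) where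
  carrier := {e | MulEquiv.toMonoidHom e ∈ F.Hom Q Q}
  one_mem' := F.conj_mem _ 1 (fun x => by simp)
  mul_mem' := fun {_ _} ha hb => F.comp_mem hb ha
  inv_mem' := fun {a} ha => F.symm_mem (R := Q) a ha

/-- `Inn(Q)` as a subgroup of `Aut_F(Q)`. -/
def inn (Q : Subgroup S) : Subgroup (F.Aut Q) :=
  (MulAut.conj : Q →* MulAut Q).range.subgroupOf (F.Aut Q)

instance inn_normal (Q : Subgroup S) : (F.inn Q).Normal where
  conj_mem := by
    rintro n ⟨q, hq⟩ g
    refine ⟨(g : MulAut Q) q, ?_⟩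
    ext x
    have h : ∀ z : Q, (n : MulAut Q) z = q * z * q⁻¹ := fun z => by
      have := DFunLike.congr_fun hq z
      simpa using this.symm
    simp [h]

/-- `Out_F(Q) = Aut_F(Q) / Inn(Q)`. -/
abbrev Out (Q : Subgroup S) : Type _ := F.Aut Q ⧸ F.inn Q

/-- `Out_P(Q)`, the image of `Aut_P(Q)` in `Out_F(Q)`. -/
def outBy (P Q : Subgroup S) : Subgroup (F.Out Q) :=
  ((autBy P Q).subgroupOf (F.Aut Q)).map (QuotientGroup.mk' (F.inn Q))

/-- `R` is an `F`-conjugate of `Q`: it is the image of `Q` under a morphism of `F`. -/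
def IsConj (Q R : Subgroup S) : Prop := ∃ φ ∈ F.Hom Q R, Function.Surjective φ

/-- `Q` is fully `F`-normalized: `|N_S(R)| ≤ |N_S(Q)|` for all `F`-conjugates `R` of `Q`. -/
def FullyNormalized (Q : Subgroup S) : Prop :=
  ∀ R : Subgroup S, F.IsConj Q R →
    Nat.card (Subgroup.normalizer (R : Set S)) ≤ Nat.card (Subgroup.normalizer (Q : Set S))

/-- `F` is saturated: `Aut_S(S)` is a Sylow `p`-subgroup of `Aut_F(S)`, and every morphism
`φ : Q → S` of `F` with fully normalized image extends to a morphism `N_φ → S` of `F`. -/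
structure Saturated (p : ℕ) : Prop where
  sylow : ∃ T : Sylow p (F.Aut ⊤), (T : Subgroup (F.Aut ⊤)) = (autBy ⊤ ⊤).subgroupOf (F.Aut ⊤)
  extend : ∀ (Q : Subgroup S) (φ : Q →* (⊤ : Subgroup S)), φ ∈ F.Hom Q ⊤ →
    F.FullyNormalized (image φ) →
    ∃ ψ ∈ F.Hom (extender φ) ⊤, ∀ u : Q, ψ (Subgroup.inclusion (le_extender φ) u) = φ u

/-- `P` is strongly `F`-closed: `F` sends no element of `P` to an element outside `P`. -/
def StronglyClosed (P : Subgroup S) : Prop :=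
  ∀ x ∈ P, ∀ φ ∈ F.Hom (Subgroup.zpowers x) ⊤,
    (φ ⟨x, Subgroup.mem_zpowers x⟩ : S) ∈ P

/-- `P` is normal in `F`, that is `F = N_F(P)`: `P` is normal in `S` and every morphism `Q → R` of `F`
extends to a morphism `PQ → PR` of `F` that maps `P` onto itself. -/
def IsNormal (P : Subgroup S) : Prop :=
  P.Normal ∧ ∀ (Q R : Subgroup S) (φ : Q →* R), φ ∈ F.Hom Q R →
    ∃ ψ ∈ F.Hom (P ⊔ Q) (P ⊔ R),
      (∀ u : Q, (ψ (Subgroup.inclusion le_sup_right u) : S) = φ u) ∧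
      image (ψ.comp (Subgroup.inclusion (le_sup_left : P ≤ P ⊔ Q))) = P

/-- `Q` is `F`-centric with respect to `P`: `C_P(ψ(Q)) ≤ ψ(Q)` for all `ψ ∈ Hom_F(Q, P)`. -/
def CentricWrt (P Q : Subgroup S) : Prop :=
  ∀ ψ ∈ F.Hom Q P, P ⊓ Subgroup.centralizer (image ψ : Set S) ≤ image ψ

/-- `Q` is an `F`-essential subgroup with respect to `P`. -/
structure EssentialWrt (p : ℕ) (P Q : Subgroup S) : Prop where
  proper : Q < P
  centric : F.CentricWrt P Q
  fullyNormalized : F.FullyNormalized Q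
  exists_embedded : ∃ H : Subgroup (F.Out Q), IsStronglyEmbedded p (F.outBy P Q) H

end FusionSystem

end

end Fusion

/-! The first half is Alperin's fusion theorem relative to `P`, proved by induction on the index of
`Q` in `P`. An isomorphism that extends to a subgroup meeting `P` in more than `Q` is settled by
induction. Pass to a fully normalized conjugate `M` of `Q`. Since `P` is normal in `S`, `N_P(Q)`
exceeds `Q` when `Q < P`. As `Aut_S(M)` is Sylow in `Aut_F(M)` (`Saturated.exists_sylow`), each
isomorphism `Q → M`, corrected by an automorphism of `M`, extends to `N_S(Q)`. Only automorphisms of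
`M` remain. If `M` is not centric, each of them extends over an element of `P` outside `M`
centralizing `M`. If `M` is centric and some automorphism does not decompose, the decomposable ones
form a proper subgroup of `Aut_F(M)` whose image in `Out_F(M)` is strongly `Out_P(M)`-embedded. Then
`M` is essential, so every automorphism of `M` is itself an allowed step
(`essentialWrt_of_not_decomposes`).

For the second half, if `P` is normal in `F` then `Out_P(Q)` is normal in `Out_F(Q)`, which rules
out a strongly embedded subgroup. Conversely, without essential subgroups each isomorphism inside
`P` extends to an automorphism of `P`. A second induction extends every isomorphism `Q → R` to `PQ →
PR`; its key is a normal `p`-subgroup of `Aut_F(M)` containing `Aut_P(M)` (`inducedOnInf`), which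
must lie in the Sylow subgroup `Aut_S(M)`. -/

namespace Fusion

/-! ### Isomorphisms of `F` as functions on `S`, and growth of normalizers -/

section

variable {S : Type*} [Group S]

theorem mem_image {Q R : Subgroup S} (φ : Q →* R) (y : S) :
    y ∈ image φ ↔ ∃ u : Q, (φ u : S) = y := by
  constructor
  · rintro ⟨_, ⟨u, rfl⟩, rfl⟩
    exact ⟨u, rfl⟩
  · rintro ⟨u, rfl⟩
    exact coe_mem_image φ u

theorem mem_autBy {P Q : Subgroup S} (e : MulAut Q) :
    e ∈ autBy P Q ↔ ∃ x ∈ P, x ∈ Subgroup.normalizer (Q : Set S) ∧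
      ∀ u : Q, (e u : S) = x * u * x⁻¹ := by
  constructor
  · rintro ⟨⟨x, hx⟩, hxP, rfl⟩
    exact ⟨x, hxP, hx, fun u => rfl⟩
  · rintro ⟨x, hxP, hx, h⟩
    exact ⟨⟨x, hx⟩, hxP, MulEquiv.ext fun u => Subtype.ext (h u).symm⟩

theorem conj_mem_of_mem_normalizer {Q : Subgroup S} {x u : S}
    (hx : x ∈ Subgroup.normalizer (Q : Set S)) (hu : u ∈ Q) : x * u * x⁻¹ ∈ Q :=
  (Subgroup.mem_normalizer_iff.1 hx u).1 hu

theorem mem_normalizer_of_conj_mem [Finite S] {Q : Subgroup S} {x : S}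
    (hx : ∀ u ∈ Q, x * u * x⁻¹ ∈ Q) : x ∈ Subgroup.normalizer (Q : Set S) := by
  rw [Subgroup.mem_normalizer_iff]
  refine fun u => ⟨hx u, fun hu => ?_⟩
  have hinj : Function.Injective fun v : Q => (⟨x * v * x⁻¹, hx v v.2⟩ : Q) := by
    intro v w h
    simpa using h
  obtain ⟨v, hv⟩ := Finite.surjective_of_injective hinj ⟨_, hu⟩
  have : (v : S) = u := by simpa using hv
  exact this ▸ v.2

namespace FusionSystem

variable (F : FusionSystem S)

/-- `f` restricts to an isomorphism `Q → R` of the category `F`. -/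
def IsoOn (f : S → S) (Q R : Subgroup S) : Prop :=
  ∃ e : Q ≃* R, e.toMonoidHom ∈ F.Hom Q R ∧ ∀ x : Q, (e x : S) = f x

variable {F} {f g : S → S} {Q R T : Subgroup S}

namespace IsoOn

theorem mem (h : F.IsoOn f Q R) {x : S} (hx : x ∈ Q) : f x ∈ R := by
  obtain ⟨e, -, he⟩ := h
  exact he ⟨x, hx⟩ ▸ (e ⟨x, hx⟩).2

theorem surj (h : F.IsoOn f Q R) {y : S} (hy : y ∈ R) : ∃ x ∈ Q, f x = y := by
  obtain ⟨e, -, he⟩ := h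
  exact ⟨e.symm ⟨y, hy⟩, (e.symm ⟨y, hy⟩).2, by rw [← he]; simp⟩

theorem inj (h : F.IsoOn f Q R) {x y : S} (hx : x ∈ Q) (hy : y ∈ Q) (hxy : f x = f y) : x = y := by
  obtain ⟨e, -, he⟩ := h
  have : e ⟨x, hx⟩ = e ⟨y, hy⟩ := Subtype.ext (by rw [he, he, hxy])
  simpa using this

theorem map_mul (h : F.IsoOn f Q R) {x y : S} (hx : x ∈ Q) (hy : y ∈ Q) :
    f (x * y) = f x * f y := by
  obtain ⟨e, -, he⟩ := h
  rw [← he ⟨x, hx⟩, ← he ⟨y, hy⟩, ← he ⟨x * y, mul_mem hx hy⟩, ← Subgroup.coe_mul, ← _root_.map_mul]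
  rfl

theorem map_inv (h : F.IsoOn f Q R) {x : S} (hx : x ∈ Q) : f x⁻¹ = (f x)⁻¹ := by
  obtain ⟨e, -, he⟩ := h
  rw [← he ⟨x, hx⟩, ← he ⟨x⁻¹, inv_mem hx⟩, ← Subgroup.coe_inv, ← _root_.map_inv]
  rfl

theorem map_conj (h : F.IsoOn f Q R) {x y : S} (hx : x ∈ Q) (hy : y ∈ Q) :
    f (x * y * x⁻¹) = f x * f y * (f x)⁻¹ := by
  rw [h.map_mul (mul_mem hx hy) (inv_mem hx), h.map_mul hx hy, h.map_inv hx]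

theorem card_eq (h : F.IsoOn f Q R) : Nat.card Q = Nat.card R := by
  obtain ⟨e, -, -⟩ := h
  exact Nat.card_congr e.toEquiv

theorem congr (h : F.IsoOn f Q R) (hfg : ∀ x ∈ Q, g x = f x) : F.IsoOn g Q R := by
  obtain ⟨e, he, h⟩ := h
  exact ⟨e, he, fun x => by rw [h, hfg x x.2]⟩

theorem trans (hf : F.IsoOn f Q R) (hg : F.IsoOn g R T) : F.IsoOn (fun x => g (f x)) Q T := by
  obtain ⟨e, he, h⟩ := hf
  obtain ⟨e', he', h'⟩ := hg
  exact ⟨e.trans e', F.comp_mem he he', fun x => by simp [h', h]⟩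

theorem symm (h : F.IsoOn f Q R) :
    ∃ g, F.IsoOn g R Q ∧ (∀ x ∈ Q, g (f x) = x) ∧ ∀ y ∈ R, f (g y) = y := by
  classical
  obtain ⟨e, he, h⟩ := h
  refine ⟨fun y => if hy : y ∈ R then e.symm ⟨y, hy⟩ else y,
    ⟨e.symm, F.symm_mem e he, fun x => by simp⟩, fun x hx => ?_, fun y hy => ?_⟩
  · have hfx : f x ∈ R := h ⟨x, hx⟩ ▸ (e ⟨x, hx⟩).2
    have : (⟨f x, hfx⟩ : R) = e ⟨x, hx⟩ := Subtype.ext (h ⟨x, hx⟩).symm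
    simp [hfx, this]
  · simp [hy, ← h]

theorem of_hom {φ : Q →* T} (hφ : φ ∈ F.Hom Q T) (hf : ∀ x : Q, (φ x : S) = f x)
    (hR : ∀ x ∈ Q, f x ∈ R) (hs : ∀ y ∈ R, ∃ x ∈ Q, f x = y) : F.IsoOn f Q R := by
  have hm : ∀ x : Q, (φ x : S) ∈ R := fun x => hf x ▸ hR x x.2
  let χ : Q →* R :=
    { toFun := fun x => ⟨φ x, hm x⟩
      map_one' := by ext; simp
      map_mul' := fun x y => by ext; simp }
  have hχ : χ ∈ F.Hom Q R := F.corestrict_mem χ hφ fun x => rfl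
  have hb : Function.Bijective χ := by
    refine ⟨F.injective_of_mem hχ, fun y => ?_⟩
    obtain ⟨x, hx, hxy⟩ := hs y y.2
    exact ⟨⟨x, hx⟩, Subtype.ext ((hf ⟨x, hx⟩).trans hxy)⟩
  exact ⟨MulEquiv.ofBijective χ hb, hχ, fun x => hf x⟩

theorem exists_of_hom {φ : Q →* T} (hφ : φ ∈ F.Hom Q T) :
    ∃ f, F.IsoOn f Q (image φ) ∧ ∀ x : Q, (φ x : S) = f x := by
  classical
  refine ⟨fun x => if hx : x ∈ Q then φ ⟨x, hx⟩ else x, of_hom hφ (fun x => by simp)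
    (fun x hx => ?_) (fun y hy => ?_), fun x => by simp⟩
  · simp only [hx, dite_true]
    exact coe_mem_image φ _
  · obtain ⟨u, rfl⟩ := (mem_image φ y).1 hy
    exact ⟨u, u.2, by simp⟩

theorem exists_hom (h : F.IsoOn f Q R) (hRT : R ≤ T) :
    ∃ φ ∈ F.Hom Q T, ∀ x : Q, (φ x : S) = f x := by
  obtain ⟨e, he, h⟩ := h
  exact ⟨(Subgroup.inclusion hRT).comp e.toMonoidHom,
    F.corestrict_mem _ he fun x => rfl, fun x => h x⟩

theorem restrict {Q' R' : Subgroup S} (h : F.IsoOn f Q R) (hQ : Q' ≤ Q)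
    (hR : ∀ x ∈ Q', f x ∈ R') (hs : ∀ y ∈ R', ∃ x ∈ Q', f x = y) : F.IsoOn f Q' R' := by
  obtain ⟨φ, hφ, hf⟩ := h.exists_hom le_top
  have hi : Subgroup.inclusion hQ ∈ F.Hom Q' Q := F.conj_mem _ 1 fun x => by simp
  exact of_hom (F.comp_mem hi hφ) (fun x => hf _) hR hs

theorem exists_restrict {Q' : Subgroup S} (h : F.IsoOn f Q R) (hQ : Q' ≤ Q) :
    ∃ R', R' ≤ R ∧ F.IsoOn f Q' R' := by
  obtain ⟨φ, hφ, hf⟩ := h.exists_hom le_top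
  refine ⟨image (φ.comp (Subgroup.inclusion hQ)), fun y hy => ?_, h.restrict hQ (fun x hx => ?_)
    fun y hy => ?_⟩
  · obtain ⟨u, rfl⟩ := (mem_image _ _).1 hy
    exact (hf (Subgroup.inclusion hQ u)).symm ▸ h.mem (hQ u.2)
  · exact (mem_image _ _).2 ⟨⟨x, hx⟩, hf ⟨x, hQ hx⟩⟩
  · obtain ⟨u, rfl⟩ := (mem_image _ _).1 hy
    exact ⟨u, u.2, (hf (Subgroup.inclusion hQ u)).symm⟩

theorem conj {x : S} (hx : x ∈ Subgroup.normalizer (Q : Set S)) :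
    F.IsoOn (fun u => x * u * x⁻¹) Q Q := by
  let e : Q ≃* Q := Q.normalizerMonoidHom ⟨x, hx⟩
  exact ⟨e, F.conj_mem _ x fun u => rfl, fun u => rfl⟩

theorem refl (Q : Subgroup S) : F.IsoOn (fun u => u) Q Q :=
  ⟨MulEquiv.refl Q, F.conj_mem _ 1 fun u => by simp, fun u => rfl⟩

theorem mem_normalizer [Finite S] {U V : Subgroup S} (hg : F.IsoOn g U V)
    (hf : F.IsoOn f Q R) (hQU : Q ≤ U) (hgf : ∀ u ∈ Q, g u = f u) {x : S} (hx : x ∈ U)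
    (hxQ : x ∈ Subgroup.normalizer (Q : Set S)) : g x ∈ Subgroup.normalizer (R : Set S) := by
  refine mem_normalizer_of_conj_mem fun v hv => ?_
  obtain ⟨u, hu, rfl⟩ := hf.surj hv
  rw [← hgf u hu, ← hg.map_conj hx (hQU hu), hgf _ (conj_mem_of_mem_normalizer hxQ hu)]
  exact hf.mem (conj_mem_of_mem_normalizer hxQ hu)

theorem isConj (h : F.IsoOn f Q R) : F.IsConj Q R := by
  obtain ⟨e, he, -⟩ := h
  exact ⟨_, he, e.surjective⟩

theorem mem_of_stronglyClosed {P : Subgroup S} (hP : F.StronglyClosed P) (h : F.IsoOn f Q R)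
    {x : S} (hx : x ∈ Q) (hxP : x ∈ P) : f x ∈ P := by
  obtain ⟨R', -, h'⟩ := h.exists_restrict (Q' := Subgroup.zpowers x) (by simpa using hx)
  obtain ⟨φ, hφ, hf⟩ := h'.exists_hom le_top
  have := hP x hxP φ hφ
  rwa [hf] at this

theorem le_of_le {P : Subgroup S} (hP : F.StronglyClosed P) (hf : F.IsoOn f Q R) (hQ : Q ≤ P) :
    R ≤ P := by
  intro y hy
  obtain ⟨x, hx, rfl⟩ := hf.surj hy
  exact hf.mem_of_stronglyClosed hP hx (hQ hx)

end IsoOn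

theorem isConj_iff : F.IsConj Q R ↔ ∃ f, F.IsoOn f Q R := by
  refine ⟨?_, fun ⟨f, hf⟩ => hf.isConj⟩
  rintro ⟨φ, hφ, hs⟩
  obtain ⟨f, hf, h⟩ := IsoOn.exists_of_hom hφ
  refine ⟨f, hf.restrict le_rfl (fun x hx => h ⟨x, hx⟩ ▸ (φ ⟨x, hx⟩).2) fun y hy => ?_⟩
  obtain ⟨x, hx⟩ := hs ⟨y, hy⟩
  exact ⟨x, x.2, by rw [← h, hx]⟩

theorem exists_aut (h : F.IsoOn f Q Q) : ∃ e ∈ F.Aut Q, ∀ x : Q, (e x : S) = f x := by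
  obtain ⟨e, he, h⟩ := h
  exact ⟨e, he, h⟩

theorem exists_isoOn_equiv {e : Q ≃* R} (he : e.toMonoidHom ∈ F.Hom Q R) :
    ∃ f, F.IsoOn f Q R ∧ ∀ x : Q, (e x : S) = f x := by
  classical
  let f : S → S := fun x => if hx : x ∈ Q then e ⟨x, hx⟩ else x
  have hf : ∀ x : Q, (e x : S) = f x := fun x => by simp [f]
  exact ⟨f, ⟨e, he, hf⟩, hf⟩

theorem exists_isoOn {e : MulAut Q} (he : e ∈ F.Aut Q) :
    ∃ f, F.IsoOn f Q Q ∧ ∀ x : Q, (e x : S) = f x :=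
  exists_isoOn_equiv (e := e) he

theorem autBy_le_aut (P Q : Subgroup S) : autBy P Q ≤ F.Aut Q := by
  intro e he
  obtain ⟨x, -, hx, h⟩ := (mem_autBy e).1 he
  exact F.conj_mem _ x h

theorem exists_fullyNormalized (F : FusionSystem S) [Finite S] (Q : Subgroup S) :
    ∃ f R, F.IsoOn f Q R ∧ F.FullyNormalized R := by
  obtain ⟨R, hR, hmax⟩ := Set.Finite.exists_maximalFor
    (fun R : Subgroup S => Nat.card (Subgroup.normalizer (R : Set S))) {R | F.IsConj Q R}
    (Set.toFinite _) ⟨Q, (IsoOn.refl Q).isConj⟩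
  obtain ⟨f, hf⟩ := isConj_iff.1 hR
  refine ⟨f, R, hf, fun T hT => ?_⟩
  obtain ⟨g, hg⟩ := isConj_iff.1 hT
  have := hmax (j := T) (hf.trans hg).isConj
  exact (le_total _ _).elim id this

/-- The extension axiom, with the domain of the extension as large as possible. -/
theorem Saturated.exists_extension {p : ℕ} (hF : F.Saturated p) (h : F.IsoOn f Q R)
    (hR : F.FullyNormalized R) :
    ∃ g U V, F.IsoOn g U V ∧ Q ≤ U ∧ (∀ u ∈ Q, g u = f u) ∧
      ∀ x ∈ Subgroup.normalizer (Q : Set S), ∀ y ∈ Subgroup.normalizer (R : Set S),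
        (∀ u ∈ Q, f (x * u * x⁻¹) = y * f u * y⁻¹) → x ∈ U := by
  obtain ⟨φ, hφ, hf⟩ := h.exists_hom le_top
  have him : image φ = R := by
    ext y
    rw [mem_image]
    constructor
    · rintro ⟨u, rfl⟩
      exact hf u ▸ h.mem u.2
    · intro hy
      obtain ⟨x, hx, rfl⟩ := h.surj hy
      exact ⟨⟨x, hx⟩, hf _⟩
  obtain ⟨ψ, hψ, hψφ⟩ := hF.extend Q φ hφ (him.symm ▸ hR)
  obtain ⟨g, hg, hgψ⟩ := IsoOn.exists_of_hom hψ
  refine ⟨g, _, _, hg, le_extender φ, fun u hu => ?_, fun x hx y hy hxy => ⟨hx, y, him.symm ▸ hy,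
    fun u v huv => ?_⟩⟩
  · rw [← hf ⟨u, hu⟩, ← hψφ ⟨u, hu⟩, hgψ]
    rfl
  · rw [hf, hf, huv, hxy u u.2]

theorem StronglyClosed.normal {P : Subgroup S} (hP : F.StronglyClosed P) : P.Normal := by
  refine ⟨fun x hx g => ?_⟩
  let φ : Subgroup.zpowers x →* (⊤ : Subgroup S) :=
    ((MulAut.conj g).toMonoidHom.comp (Subgroup.subtype _)).codRestrict ⊤ fun _ =>
      Subgroup.mem_top _
  exact hP x hx φ (F.conj_mem φ g fun u => rfl)

end FusionSystem

theorem exists_mem_normalizer_of_lt {p : ℕ} [Fact p.Prime] [Finite S] {R U : Subgroup S}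
    (hU : IsPGroup p U) (h : R < U) :
    ∃ x ∈ U, x ∈ Subgroup.normalizer (R : Set S) ∧ x ∉ R := by
  have hn : Group.IsNilpotent U := hU.isNilpotent
  have hlt : R.subgroupOf U < ⊤ := by
    rw [lt_top_iff_ne_top, Ne, Subgroup.subgroupOf_eq_top]
    exact fun h' => h.not_ge h'
  obtain ⟨x, hx, hxR⟩ := SetLike.exists_of_lt (Group.normalizerCondition_of_isNilpotent _ hlt)
  refine ⟨x, x.2, mem_normalizer_of_conj_mem fun u hu => ?_, hxR⟩
  exact conj_mem_of_mem_normalizer (u := ⟨u, h.le hu⟩) hx hu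

/-- Normalizers grow in the `p`-group `PR`; the factor in `R` of the new element normalizes `R` and
can be stripped off. -/
theorem exists_mem_normalizer_not_mem {p : ℕ} [Fact p.Prime] [Finite S] (hS : IsPGroup p S)
    {P R : Subgroup S} [P.Normal] (h : ¬ P ≤ R) :
    ∃ y ∈ P, y ∈ Subgroup.normalizer (R : Set S) ∧ y ∉ R := by
  obtain ⟨x, hx, hxn, hxR⟩ := exists_mem_normalizer_of_lt (R := R) (hS.to_subgroup (P ⊔ R))
    (right_lt_sup.2 h)
  obtain ⟨y, hy, z, hz, rfl⟩ := Subgroup.mem_sup_of_normal_left.1 hx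
  refine ⟨y, hy, ?_, fun hyR => hxR (mul_mem hyR hz)⟩
  simpa using mul_mem hxn (inv_mem (Subgroup.le_normalizer hz))

end

end Fusion

/-! ### Fully normalized subgroups are fully automized -/

namespace Fusion

/-- Replaces `x` by a `p`-element without changing its action wherever that action has order
dividing `p ^ k`: `m` is also chosen divisible by the `p'`-part of the order of `x`. -/
theorem exists_pow_isPGroup_zpowers {G : Type*} [Group G] [Finite G] (p k : ℕ) [hp : Fact p.Prime]
    (x : G) : ∃ m : ℕ, m ≡ 1 [MOD p ^ k] ∧ IsPGroup p (Subgroup.zpowers (x ^ m)) := by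
  obtain ⟨a, m', hm', ha⟩ := Nat.exists_eq_pow_mul_and_not_dvd (orderOf_pos x).ne' p hp.out.ne_one
  have hc : Nat.Coprime (p ^ k) m' := Nat.Coprime.pow_left _ ((hp.out.coprime_iff_not_dvd).2 hm')
  obtain ⟨m, hm, hm0⟩ := Nat.chineseRemainder hc 1 0
  refine ⟨m, hm, ?_⟩
  have hx : (x ^ m) ^ p ^ a = 1 := by
    rw [← pow_mul, ← orderOf_dvd_iff_pow_eq_one, ha, mul_comm]
    exact mul_dvd_mul ((Nat.modEq_zero_iff_dvd).1 hm0) dvd_rfl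
  rintro ⟨_, n, rfl⟩
  refine ⟨a, Subtype.ext ?_⟩
  show ((x ^ m) ^ n) ^ p ^ a = 1
  rw [← zpow_natCast, zpow_comm, zpow_natCast, hx, one_zpow]

theorem exists_conj_mem_sylow {G : Type*} [Group G] [Finite G] {p : ℕ} [Fact p.Prime]
    (T : Sylow p G) {K : Subgroup G} (hK : IsPGroup p K) : ∃ g : G, ∀ k ∈ K, g * k * g⁻¹ ∈ (T : Subgroup G) := by
  obtain ⟨T', hT'⟩ := hK.exists_le_sylow
  obtain ⟨g, rfl⟩ := MulAction.exists_smul_eq G T' T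
  exact ⟨g, fun k hk => (Subgroup.smul_mem_pointwise_smul (k : G) (MulAut.conj g) _ (hT' hk))⟩

variable {S : Type*} [Group S]

namespace FusionSystem

variable {F : FusionSystem S} {f g : S → S} {Q R : Subgroup S}

theorem IsoOn.exists_eq_self [Finite S] (h : F.IsoOn f Q R) {N : Subgroup S} (hN : N ≤ Q)
    (hf : ∀ x ∈ N, f x ∈ N) : F.IsoOn f N N := by
  obtain ⟨N', -, h'⟩ := h.exists_restrict hN
  have : N' = N := Subgroup.eq_of_le_of_card_ge
    (fun y hy => by obtain ⟨x, hx, rfl⟩ := h'.surj hy; exact hf x hx) h'.card_eq.le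
  rwa [this] at h'

/-- If `Aut_S(R)` is a Sylow subgroup of `Aut_F(R)`, then every `p`-subgroup of `Aut_F(Q)` is
transported into `Aut_S(R)` by some isomorphism `Q → R`. -/
theorem exists_transport [Finite S] {p : ℕ} [Fact p.Prime]
    (hT : ∃ T : Sylow p (F.Aut R), (T : Subgroup (F.Aut R)) = (autBy ⊤ R).subgroupOf (F.Aut R))
    (hf : F.IsoOn f Q R) {K : Subgroup (MulAut Q)} (hK : IsPGroup p K) (hKF : K ≤ F.Aut Q) :
    ∃ a, F.IsoOn a R R ∧ ∀ k ∈ K, ∃ y ∈ Subgroup.normalizer (R : Set S),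
      ∀ u : Q, a (f (k u : Q)) = y * a (f u) * y⁻¹ := by
  obtain ⟨T, hT⟩ := hT
  obtain ⟨t, ht, htf⟩ := hf
  have hmem : ∀ k ∈ K, MulAut.congr t k ∈ F.Aut R := fun k hk =>
    F.comp_mem (F.symm_mem t ht) (F.comp_mem (hKF hk) ht)
  have hK' : IsPGroup p ((K.map (MulAut.congr t).toMonoidHom).subgroupOf (F.Aut R)) :=
    (hK.map _).comap_of_injective _ Subtype.val_injective
  obtain ⟨e, he⟩ := exists_conj_mem_sylow T hK'
  obtain ⟨a, ha, hea⟩ := exists_isoOn e.2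
  refine ⟨a, ha, fun k hk => ?_⟩
  have h1 := he ⟨_, hmem k hk⟩ (Subgroup.mem_map_of_mem _ hk)
  rw [hT, Subgroup.mem_subgroupOf, mem_autBy] at h1
  obtain ⟨y, -, hy, h⟩ := h1
  refine ⟨y, hy, fun u => ?_⟩
  have := h ((e : MulAut R) (t u))
  simp only [← htf, ← hea]
  simpa [MulAut.congr] using this

theorem isPGroup_autBy {p : ℕ} (hS : IsPGroup p S) (P Q : Subgroup S) :
    IsPGroup p (autBy P Q) :=
  ((hS.to_subgroup _).to_subgroup _).map _

/-- A fully normalized subgroup is fully automized. -/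
theorem Saturated.exists_sylow [Finite S] {p : ℕ} [Fact p.Prime] (hS : IsPGroup p S)
    (hF : F.Saturated p) (hR : F.FullyNormalized R) :
    ∃ T : Sylow p (F.Aut R), (T : Subgroup (F.Aut R)) = (autBy ⊤ R).subgroupOf (F.Aut R) := by
  induction hn : Nat.card S - Nat.card R using Nat.strong_induction_on generalizing R with
  | _ n ih =>
  subst hn
  by_cases hRtop : R = ⊤
  · subst hRtop
    exact hF.sylow
  obtain ⟨T, hT⟩ := ((isPGroup_autBy hS ⊤ R).comap_of_injective (F.Aut R).subtype
    Subtype.val_injective).exists_le_sylow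
  refine ⟨T, (hT.antisymm ?_).symm⟩
  by_contra hTA
  -- If `Aut_S(R)` is not Sylow, some `p`-element `φ` outside it normalizes it. The contradiction
  -- will be that `φ` is conjugation by an element of `S`.
  obtain ⟨φ, hφT, hφn, hφ⟩ := exists_mem_normalizer_of_lt T.2 (lt_of_le_not_ge hT hTA)
  obtain ⟨f, hf, hφf⟩ := exists_isoOn φ.2
  apply hφ
  rw [Subgroup.mem_comap, Subgroup.coe_subtype, mem_autBy]
  obtain ⟨g, U, V, hg, hRU, hgf, hU⟩ := hF.exists_extension hf hR
  set N := Subgroup.normalizer (R : Set S) with hN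
  have hRN : R ≤ N := Subgroup.le_normalizer
  -- Since `φ` normalizes `Aut_S(R)`, it carries every conjugation by `N_S(R)` to another, so it
  -- extends to all of `N_S(R)`.
  have hNU : N ≤ U := by
    intro x hx
    have hcx : R.normalizerMonoidHom ⟨x, hx⟩ ∈ autBy ⊤ R :=
      (mem_autBy _).2 ⟨x, Subgroup.mem_top x, hx, fun u => rfl⟩
    have h1 := conj_mem_of_mem_normalizer (u := ⟨_, autBy_le_aut _ _ hcx⟩) hφn hcx
    rw [Subgroup.mem_comap, Subgroup.coe_subtype, mem_autBy] at h1
    obtain ⟨y, -, hy, h⟩ := h1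
    refine hU x hx y hy fun u hu => ?_
    have h2 := h ((φ : MulAut R) ⟨u, hu⟩)
    rw [← hφf ⟨u, hu⟩, ← hφf ⟨_, conj_mem_of_mem_normalizer hx hu⟩, ← h2]
    simp
    rfl
  have hgN : F.IsoOn g N N := hg.exists_eq_self hNU fun x hx => hg.mem_normalizer hf hRU hgf (hNU hx) hx
  obtain ⟨e, he, heg⟩ := exists_aut hgN
  have hrestr : ∀ m : ℕ, ∀ u : R, (((e ^ m) ⟨u, hRN u.2⟩ : N) : S) = ((φ : MulAut R) ^ m) u := by
    intro m
    induction m with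
    | zero => intro u; simp
    | succ m ihm =>
      intro u
      rw [pow_succ, pow_succ, MulAut.mul_apply, MulAut.mul_apply, ← ihm]
      congr 2
      exact Subtype.ext ((heg _).trans ((hgf _ u.2).trans (hφf u).symm))
  obtain ⟨k, hk⟩ := T.2 ⟨φ, hφT⟩
  -- The extension `e` need not have `p`-power order; `e ^ m` does and still restricts to `φ`.
  obtain ⟨m, hm, hpm⟩ := exists_pow_isPGroup_zpowers p k e
  have hφm : (φ : MulAut R) ^ m = φ := by
    have h1 : φ ^ p ^ k = 1 := congrArg Subtype.val hk
    have h2 : φ ^ m = φ ^ 1 := pow_eq_pow_iff_modEq.2 (hm.of_dvd (orderOf_dvd_of_pow_eq_one h1))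
    simpa using congrArg Subtype.val h2
  obtain ⟨τ, M, hτ, hM⟩ := exists_fullyNormalized F N
  have hcard : Nat.card S - Nat.card M < Nat.card S - Nat.card R := by
    obtain ⟨x, -, hx, hxR⟩ := exists_mem_normalizer_of_lt (hS.to_subgroup ⊤)
      (lt_top_iff_ne_top.2 hRtop)
    have h1 : R < N := SetLike.lt_iff_le_and_exists.2 ⟨hRN, x, hx, hxR⟩
    have h2 : Nat.card R < Nat.card N :=
      lt_of_not_ge fun hle => h1.ne (Subgroup.eq_of_le_of_card_ge h1.le hle)
    have h3 := N.card_le_card_group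
    have := hτ.card_eq
    omega
  -- By induction `Aut_S(M)` is Sylow for the fully normalized conjugate `M` of `N_S(R)`, so `e ^ m`
  -- becomes conjugation by some `y` in `N_S(M)`.
  obtain ⟨a, ha, hK⟩ := exists_transport (ih _ hcard hM rfl) hτ hpm
    ((Subgroup.zpowers_le).2 (pow_mem he m))
  obtain ⟨y, hy, hay⟩ := hK _ (Subgroup.mem_zpowers _)
  have hh := hτ.trans ha
  obtain ⟨R', hR'M, hh'⟩ := hh.exists_restrict hRN
  have key : ∀ u : R, a (τ ((φ : MulAut R) u)) = y * a (τ u) * y⁻¹ := by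
    intro u
    rw [← hay ⟨u, hRN u.2⟩, hrestr, hφm]
  have hyn : y ∈ Subgroup.normalizer (R' : Set S) := by
    refine mem_normalizer_of_conj_mem fun v hv => ?_
    obtain ⟨u, hu, rfl⟩ := hh'.surj hv
    rw [← key ⟨u, hu⟩]
    exact hh'.mem ((φ : MulAut R) ⟨u, hu⟩).2
  -- `M` normalizes the image `R'` of `R`, and full normalization of `R` leaves no room for more.
  -- Hence `y`, which normalizes `R'`, lies in `M` and pulls back to `N_S(R)`.
  have hMn : M = Subgroup.normalizer (R' : Set S) := by
    refine Subgroup.eq_of_le_of_card_ge (fun v hv => ?_) (hh.card_eq ▸ hR R' hh'.isConj)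
    obtain ⟨x, hx, rfl⟩ := hh.surj hv
    exact hh.mem_normalizer hh' hRN (fun _ _ => rfl) hx hx
  obtain ⟨x, hx, rfl⟩ := hh.surj (hMn ▸ hyn)
  refine ⟨x, Subgroup.mem_top x, hx, fun u => hh.inj (hRN (_ : R).2)
    (hRN (conj_mem_of_mem_normalizer hx u.2)) ?_⟩
  rw [key, hh.map_conj hx (hRN u.2)]

/-- An isomorphism `Q → R` with `R` fully normalized extends to `N_S(Q)` after composition with a
suitable automorphism of `R`. -/
theorem Saturated.exists_extension_normalizer [Finite S] {p : ℕ} [Fact p.Prime]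
    (hS : IsPGroup p S) (hF : F.Saturated p) (hR : F.FullyNormalized R) (hf : F.IsoOn f Q R) :
    ∃ a g V, F.IsoOn a R R ∧ F.IsoOn g (Subgroup.normalizer (Q : Set S)) V ∧
      ∀ u ∈ Q, g u = a (f u) := by
  obtain ⟨a, ha, hK⟩ := exists_transport (hF.exists_sylow hS hR) hf (isPGroup_autBy hS ⊤ Q)
    (autBy_le_aut _ _)
  obtain ⟨g, U, V, hg, hQU, hgf, hU⟩ := hF.exists_extension (hf.trans ha) hR
  have hNU : Subgroup.normalizer (Q : Set S) ≤ U := by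
    intro x hx
    obtain ⟨y, hy, h⟩ := hK (Q.normalizerMonoidHom ⟨x, hx⟩)
      ((mem_autBy _).2 ⟨x, Subgroup.mem_top x, hx, fun u => rfl⟩)
    exact hU x hx y hy fun u hu => h ⟨u, hu⟩
  obtain ⟨V', -, hg'⟩ := hg.exists_restrict hNU
  exact ⟨a, g, V', ha, hg', hgf⟩

end FusionSystem

end Fusion

/-! ### A criterion for strong embedding, and the calculus of decompositions -/

namespace Fusion

theorem mem_conjSubgroup {G : Type*} [Group G] {H : Subgroup G} {g x : G} :
    x ∈ conjSubgroup H g ↔ g * x * g⁻¹ ∈ H := by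
  constructor
  · rintro ⟨y, hy, rfl⟩
    simpa [mul_assoc] using hy
  · exact fun h => ⟨_, h, by simp [mul_assoc]⟩

/-- A criterion for the image of `H` in `G / N` to be strongly embedded, in terms of `G`. -/
theorem isStronglyEmbedded_map_mk {G : Type*} [Group G] [Finite G] {p : ℕ} [Fact p.Prime]
    {N D H : Subgroup G} [N.Normal] (T : Sylow p G) (hND : N ≤ D) (hDN : ¬ D ≤ N)
    (hD : StronglyClosedIn D (T : Subgroup G)) (hTH : (T : Subgroup G) ≤ H) (hH : H ≠ ⊤)
    (h : ∀ d ∈ D, d ∉ N → ∀ a : G, a⁻¹ * d * a ∈ D → a ∈ H) :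
    IsStronglyEmbedded p (D.map (QuotientGroup.mk' N)) (H.map (QuotientGroup.mk' N)) := by
  have hmap : ∀ {K : Subgroup G}, N ≤ K → ∀ {x : G},
      QuotientGroup.mk' N x ∈ K.map (QuotientGroup.mk' N) ↔ x ∈ K := by
    intro K hK x
    rw [← Subgroup.mem_comap, Subgroup.comap_map_eq_self (by simpa using hK)]
  have hNT := hND.trans hD.1
  have hNH := hNT.trans hTH
  -- Weakens "conjugate in `D`" to "conjugate in `H`": `T` is Sylow in `H`, so the conjugate moves
  -- into `T` inside `H`, and strong closure then puts it in `D`.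
  have hfus : ∀ d ∈ D, d ∉ N → ∀ a : G, a⁻¹ * d * a ∈ H → a ∈ H := by
    intro d hd hdN a ha
    have hp : IsPGroup p ((Subgroup.zpowers (a⁻¹ * d * a)).subgroupOf H) := by
      have h1 : IsPGroup p (Subgroup.zpowers d) := T.2.to_le (by simpa using hD.1 hd)
      have h2 : Subgroup.zpowers (a⁻¹ * d * a) =
          (Subgroup.zpowers d).map (MulAut.conj a⁻¹).toMonoidHom := by
        simp [MonoidHom.map_zpowers]
      exact (h2 ▸ h1.map _ : IsPGroup p (Subgroup.zpowers (a⁻¹ * d * a))).comap_of_injective _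
        Subtype.val_injective
    obtain ⟨b, hb⟩ := exists_conj_mem_sylow (T.subtype hTH) hp
    have h1 : (b : G) * (a⁻¹ * d * a) * (b : G)⁻¹ ∈ T :=
      hb ⟨_, ha⟩ (Subgroup.mem_zpowers (a⁻¹ * d * a))
    have h2 : (a * (b : G)⁻¹)⁻¹ * d * (a * (b : G)⁻¹) ∈ T := by
      convert h1 using 1
      group
    simpa using mul_mem (h d hd hdN _ (hD.2 d hd _ h2)) b.2
  refine ⟨?_, ⟨T.mapSurjective (QuotientGroup.mk'_surjective N), ?_, ?_⟩, ?_, ⟨1, ?_⟩, ?_⟩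
  · rw [Ne, Subgroup.map_eq_bot_iff, QuotientGroup.ker_mk']
    exact hDN
  · rw [Sylow.coe_mapSurjective]
    exact Subgroup.map_mono hD.1
  · rintro _ ⟨d, hd, rfl⟩ g hg
    obtain ⟨a, rfl⟩ := QuotientGroup.mk'_surjective N g
    rw [Sylow.coe_mapSurjective, ← map_inv, ← map_mul, ← map_mul, hmap hNT] at hg
    rw [← map_inv, ← map_mul, ← map_mul, hmap hND]
    exact hD.2 d hd a hg
  · intro hmt
    refine hH (eq_top_iff.2 fun x _ => (hmap hNH).1 ?_)
    rw [hmt]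
    exact Subgroup.mem_top _
  · intro x hx
    rw [mem_conjSubgroup] at hx
    exact Subgroup.map_mono (hD.1.trans hTH) (by simpa using hx)
  · intro g hg U hU hU1 y hle
    obtain ⟨u, huU, hu1⟩ := (Subgroup.bot_or_exists_ne_one U).resolve_left hU1
    obtain ⟨d, hd, hdu⟩ := hU huU
    obtain ⟨a, rfl⟩ := QuotientGroup.mk'_surjective N g
    obtain ⟨b, rfl⟩ := QuotientGroup.mk'_surjective N y
    have hdN : d ∉ N := by
      rw [← QuotientGroup.ker_mk' N, MonoidHom.mem_ker, hdu]
      exact hu1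
    have hx : QuotientGroup.mk' N (b⁻¹ * d * b) ∈ conjSubgroup U (QuotientGroup.mk' N b) := by
      rw [mem_conjSubgroup]
      simp only [map_mul, map_inv, hdu]
      simpa [mul_assoc] using huU
    have h1 := hle hx
    rw [Subgroup.mem_inf, mem_conjSubgroup, ← map_inv, ← map_mul, ← map_mul, hmap hNH,
      hmap hNH] at h1
    rw [hmap hNH] at hg
    -- An element of `H ∩ H^a` conjugate to `d` by `b` forces both `b` and `b * a⁻¹` into `H`, hence
    -- `a` too.
    have hb := hfus d hd hdN b h1.1
    have hba := hfus d hd hdN (b * a⁻¹) (by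
      convert h1.2 using 1
      group)
    refine hg ?_
    simpa using mul_mem (inv_mem hba) hb

namespace FusionSystem

variable {S : Type*} [Group S]

/-- `f` restricts to an isomorphism `Q → R` that is a composite of restrictions of
`F`-automorphisms of `P` and of subgroups that are `F`-essential with respect to `P`. -/
inductive Decomposes (F : FusionSystem S) (p : ℕ) (P : Subgroup S) :
    (S → S) → Subgroup S → Subgroup S → Prop
  | nil {f : S → S} {Q : Subgroup S} (hQ : Q ≤ P) (hf : ∀ x ∈ Q, f x = x) : Decomposes F p P f Q Q
  | cons {f g h : S → S} {Q Q' R T : Subgroup S} (hT : F.EssentialWrt p P T ∨ T = P) (hQ : Q ≤ T)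
      (hg : F.IsoOn g T T) (hgQ : F.IsoOn g Q Q') (hf : Decomposes F p P f Q' R)
      (hh : ∀ x ∈ Q, h x = f (g x)) : Decomposes F p P h Q R

variable {F : FusionSystem S} {p : ℕ} {P Q R T : Subgroup S} {f g h : S → S}

namespace Decomposes

theorem isoOn (hf : F.Decomposes p P f Q R) : F.IsoOn f Q R := by
  induction hf with
  | nil hQ hf => exact (IsoOn.refl _).congr hf
  | cons hT hQ hg hgQ hf hh ih => exact (hgQ.trans ih).congr hh

theorem congr (hf : F.Decomposes p P f Q R) (hfg : ∀ x ∈ Q, g x = f x) :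
    F.Decomposes p P g Q R := by
  cases hf with
  | nil hQ hf => exact nil hQ fun x hx => (hfg x hx).trans (hf x hx)
  | cons hT hQ hg hgQ hf hh => exact cons hT hQ hg hgQ hf fun x hx => (hfg x hx).trans (hh x hx)

theorem trans (hf : F.Decomposes p P f Q R) (hg : F.Decomposes p P g R T) :
    F.Decomposes p P (fun x => g (f x)) Q T := by
  induction hf with
  | nil hQ hf => exact hg.congr fun x hx => by rw [hf x hx]
  | cons hT hQ hk hkQ hf hh ih => exact cons hT hQ hk hkQ (ih hg) fun x hx => by rw [hh x hx]

theorem le_of_essential (hT : F.EssentialWrt p P T ∨ T = P) : T ≤ P :=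
  hT.elim (fun h => h.proper.le) le_of_eq

theorem single (hT : F.EssentialWrt p P T ∨ T = P) (hQ : Q ≤ T) (hg : F.IsoOn g T T)
    (hgQ : F.IsoOn g Q R) : F.Decomposes p P g Q R := by
  refine cons hT hQ hg hgQ (nil (f := fun x => x) ?_ fun _ _ => rfl) fun _ _ => rfl
  intro y hy
  obtain ⟨x, hx, rfl⟩ := hgQ.surj hy
  exact le_of_essential hT (hg.mem (hQ hx))

theorem symm (hf : F.Decomposes p P f Q R) :
    ∃ g, F.Decomposes p P g R Q ∧ ∀ x ∈ Q, g (f x) = x := by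
  induction hf with
  | nil hQ hf => exact ⟨_, nil hQ hf, fun x hx => by rw [hf x hx, hf x hx]⟩
  | @cons f k h Q Q' R T hT hQ hk hkQ hf hh ih =>
    obtain ⟨g, hg, hgf⟩ := ih
    obtain ⟨k', hk', hkk', hk'k⟩ := hk.symm
    have hk'Q : F.IsoOn k' Q' Q := by
      refine hk'.restrict (fun y hy => ?_) (fun y hy => ?_) fun x hx => ?_
      · obtain ⟨x, hx, rfl⟩ := hkQ.surj hy
        exact hk.mem (hQ hx)
      · obtain ⟨x, hx, rfl⟩ := hkQ.surj hy
        rwa [hkk' x (hQ hx)]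
      · exact ⟨k x, hkQ.mem hx, hkk' x (hQ hx)⟩
    refine ⟨_, hg.trans (single hT (fun y hy => ?_) hk' hk'Q), fun x hx => ?_⟩
    · obtain ⟨x, hx, rfl⟩ := hkQ.surj hy
      exact hk.mem (hQ hx)
    · rw [hh x hx, hgf _ (hkQ.mem hx), hkk' x (hQ hx)]

theorem restrict (hf : F.Decomposes p P f Q R) {Q' R' : Subgroup S} (hQ : Q' ≤ Q)
    (h : F.IsoOn f Q' R') : F.Decomposes p P f Q' R' := by
  induction hf generalizing Q' with
  | nil hQP hf =>
    have : R' = Q' := by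
      ext y
      constructor
      · intro hy
        obtain ⟨x, hx, rfl⟩ := h.surj hy
        rwa [hf x (hQ hx)]
      · intro hy
        rw [← hf y (hQ hy)]
        exact h.mem hy
    subst this
    exact nil (hQ.trans hQP) fun x hx => hf x (hQ hx)
  | cons hT hQT hk hkQ hf hh ih =>
    obtain ⟨Q'', hQ'', hk'⟩ := hkQ.exists_restrict hQ
    refine cons hT (hQ.trans hQT) hk hk' (ih hQ'' ?_) fun x hx => hh x (hQ hx)
    refine hf.isoOn.restrict hQ'' (fun y hy => ?_) fun z hz => ?_
    · obtain ⟨x, hx, rfl⟩ := hk'.surj hy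
      rw [← hh x (hQ hx)]
      exact h.mem hx
    · obtain ⟨x, hx, rfl⟩ := h.surj hz
      exact ⟨_, hk'.mem hx, (hh x (hQ hx)).symm⟩

theorem exists_sequence (hf : F.Decomposes p P f Q R) :
    ∃ (n : ℕ) (Qs Ss : ℕ → Subgroup S) (a : ℕ → S → S), Qs 0 = Q ∧ Qs n = R ∧
      (∀ i ≤ n, Qs i ≤ P) ∧
      (∀ i < n, (F.EssentialWrt p P (Ss i) ∨ Ss i = P) ∧ Qs i ≤ Ss i ∧
        F.IsoOn (a i) (Ss i) (Ss i) ∧ F.IsoOn (a i) (Qs i) (Qs (i + 1))) ∧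
      ∀ x ∈ Q, ∃ y : ℕ → S, y 0 = x ∧ y n = f x ∧
        ∀ i < n, y i ∈ Qs i ∧ y (i + 1) = a i (y i) := by
  induction hf with
  | @nil f Q hQ hf =>
    exact ⟨0, fun _ => Q, fun _ => Q, fun _ => f, rfl, rfl, fun _ _ => hQ, fun i hi => by omega,
      fun x hx => ⟨fun _ => x, rfl, (hf x hx).symm, fun i hi => by omega⟩⟩
  | @cons f g h Q Q' R T hT hQ hg hgQ hf hh ih =>
    obtain ⟨n, Qs, Ss, a, h0, hn, hP, hstep, hy⟩ := ih
    refine ⟨n + 1, fun i => Nat.casesOn i Q Qs, fun i => Nat.casesOn i T Ss,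
      fun i => Nat.casesOn i g a, rfl, hn, ?_, ?_, fun x hx => ?_⟩
    · rintro (_ | i) hi
      · exact hQ.trans (le_of_essential hT)
      · exact hP i (by omega)
    · rintro (_ | i) hi
      · exact ⟨hT, hQ, hg, by simpa [h0] using hgQ⟩
      · exact hstep i (by omega)
    · obtain ⟨y, y0, yn, hy⟩ := hy (g x) (hgQ.mem hx)
      refine ⟨fun i => Nat.casesOn i x y, rfl, yn.trans (hh x hx).symm, ?_⟩
      rintro (_ | i) hi
      · exact ⟨hx, y0⟩
      · exact hy i (by omega)

theorem exists_fin_sequence {ψ : Q ≃* R} (hf : F.Decomposes p P f Q R)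
    (hψ : ∀ x : Q, (ψ x : S) = f x) :
    ∃ (n : ℕ) (Qs : Fin (n + 1) → Subgroup S) (Ss : Fin n → Subgroup S)
        (ψs : ∀ i : Fin n, MulAut (Ss i)),
        Qs 0 = Q ∧ Qs (Fin.last n) = R ∧
        (∀ i, Qs i ≤ P ∧ Nonempty (Q ≃* Qs i)) ∧
        (∀ i, F.EssentialWrt p P (Ss i) ∨ Ss i = P) ∧
        (∀ i, Qs i.castSucc ≤ Ss i ∧ Qs i.succ ≤ Ss i) ∧
        (∀ i, ψs i ∈ F.Aut (Ss i)) ∧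
        (∀ i, ((Qs i.castSucc).subgroupOf (Ss i)).map (ψs i).toMonoidHom =
          (Qs i.succ).subgroupOf (Ss i)) ∧
        (∀ x : Q, ∃ y : Fin (n + 1) → S,
          y 0 = x ∧ y (Fin.last n) = ψ x ∧
          ∀ i : Fin n, ∃ h : y i.castSucc ∈ Ss i, (ψs i ⟨y i.castSucc, h⟩ : S) = y i.succ) := by
  obtain ⟨n, Qs, Ss, a, h0, hn, hP, hstep, hy⟩ := hf.exists_sequence
  choose ψs hψs hψa using fun i : Fin n => exists_aut (hstep i i.2).2.2.1
  have hle : ∀ i : Fin n, Qs (i + 1) ≤ Ss i := by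
    intro i y hy
    obtain ⟨x, hx, rfl⟩ := (hstep i i.2).2.2.2.surj hy
    exact (hstep i i.2).2.2.1.mem ((hstep i i.2).2.1 hx)
  have hiso : ∀ i ≤ n, ∃ k, F.IsoOn k Q (Qs i) := by
    intro i
    induction i with
    | zero => exact fun _ => ⟨fun u => u, h0.symm ▸ IsoOn.refl Q⟩
    | succ i ih =>
      intro hi
      obtain ⟨k, hk⟩ := ih (by omega)
      exact ⟨_, hk.trans (hstep i (by omega)).2.2.2⟩
  refine ⟨n, fun i => Qs i, fun i => Ss i, ψs, h0, hn, fun i => ⟨hP i (by omega), ?_⟩,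
    fun i => (hstep i i.2).1, fun i => ⟨(hstep i i.2).2.1, hle i⟩, hψs, fun i => ?_, fun x => ?_⟩
  · obtain ⟨k, e, -⟩ := hiso i (by omega)
    exact ⟨e⟩
  · have hi := (hstep i i.2).2.2.2
    ext z
    constructor
    · rintro ⟨w, hw, rfl⟩
      exact Subgroup.mem_subgroupOf.2 ((hψa i w).symm ▸ hi.mem hw)
    · intro hz
      obtain ⟨w, hw, hwz⟩ := hi.surj (Subgroup.mem_subgroupOf.1 hz)
      exact ⟨⟨w, (hstep i i.2).2.1 hw⟩, hw, Subtype.ext ((hψa i _).trans hwz)⟩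
  · obtain ⟨y, y0, yn, hy⟩ := hy x x.2
    exact ⟨fun i => y i, y0, yn.trans (hψ x).symm, fun i =>
      ⟨(hstep i i.2).2.1 (hy i i.2).1, (hψa i _).trans (hy i i.2).2.symm⟩⟩

end Decomposes

end FusionSystem

end Fusion

/-! ### The fusion theorem relative to `P` -/

namespace Fusion

namespace FusionSystem

variable {S : Type*} [Group S] [Finite S]

variable {F : FusionSystem S} {p : ℕ} {P Q R : Subgroup S}

/-- The inductive engine: `U ∩ P` is strictly larger than `Q`, so `g` decomposes there, and
decompositions restrict. -/
theorem decomposes_of_extension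
    (ih : ∀ (Q' R' : Subgroup S) (f : S → S), Nat.card Q < Nat.card Q' → Q' ≤ P →
      F.IsoOn f Q' R' → F.Decomposes p P f Q' R')
    {f g : S → S} {U V : Subgroup S} (hg : F.IsoOn g U V) (hQU : Q ≤ U) (hQP : Q ≤ P) {x : S}
    (hxU : x ∈ U) (hxP : x ∈ P) (hxQ : x ∉ Q) (hf : F.IsoOn f Q R) (hgf : ∀ u ∈ Q, g u = f u) :
    F.Decomposes p P f Q R := by
  obtain ⟨V', -, hg'⟩ := hg.exists_restrict (Q' := U ⊓ P) inf_le_left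
  have hlt : Nat.card Q < Nat.card (U ⊓ P : Subgroup S) := by
    refine lt_of_not_ge fun hle => hxQ ?_
    rw [Subgroup.eq_of_le_of_card_ge (le_inf hQU hQP) hle]
    exact ⟨hxU, hxP⟩
  exact ((ih _ _ _ hlt inf_le_right hg').restrict (le_inf hQU hQP) (hf.congr hgf)).congr
    fun u hu => (hgf u hu).symm

/-- Failure of centricity, witnessed at some conjugate of `R`, is moved to `R`: an element
centralizing the conjugate lies in the extender of the isomorphism back to `R`, with `y = 1`. -/
theorem exists_mem_centralizing (hF : F.Saturated p) (hP : F.StronglyClosed P)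
    (hR : F.FullyNormalized R) (hc : ¬ F.CentricWrt P R) : ∃ z ∈ P, z ∉ R ∧ ∀ u ∈ R, z * u * z⁻¹ = u := by
  simp only [CentricWrt, not_forall] at hc
  obtain ⟨ψ, hψ, hc⟩ := hc
  obtain ⟨x, ⟨hxP, hxc⟩, hx⟩ := SetLike.not_le_iff_exists.1 hc
  obtain ⟨f, hf, -⟩ := IsoOn.exists_of_hom hψ
  obtain ⟨k, hk, -, -⟩ := hf.symm
  obtain ⟨g, U, V, hg, hQU, hgk, hU⟩ := hF.exists_extension hk hR
  have hxu : ∀ u ∈ image ψ, x * u * x⁻¹ = u := fun u hu => by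
    rw [← Subgroup.mem_centralizer_iff.1 hxc u hu, mul_inv_cancel_right]
  have hxU : x ∈ U := hU x (mem_normalizer_of_conj_mem fun u hu => (hxu u hu).symm ▸ hu) 1
    (one_mem _) fun u hu => by rw [hxu u hu]; simp
  refine ⟨g x, hg.mem_of_stronglyClosed hP hxU hxP, fun hgx => hx ?_, fun u hu => ?_⟩
  · obtain ⟨v, hv, hvx⟩ := hk.surj hgx
    rw [← hgk v hv] at hvx
    exact hg.inj (hQU hv) hxU hvx ▸ hv
  · obtain ⟨v, hv, rfl⟩ := hk.surj hu
    rw [← hgk v hv, ← hg.map_conj hxU (hQU hv), hxu v hv]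

/-- The `F`-automorphisms of `R` that are composites of restrictions of automorphisms of `P` and of
essential subgroups. -/
def decomposable (F : FusionSystem S) (p : ℕ) (P R : Subgroup S) (hR : R ≤ P) :
    Subgroup (F.Aut R) where
  carrier := {e | ∃ f, F.Decomposes p P f R R ∧ ∀ u : R, ((e : MulAut R) u : S) = f u}
  one_mem' := ⟨fun u => u, .nil hR fun _ _ => rfl, fun u => rfl⟩
  mul_mem' := by
    rintro a b ⟨f, hf, haf⟩ ⟨g, hg, hbg⟩
    refine ⟨_, hg.trans hf, fun u => ?_⟩
    rw [← hbg, ← haf]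
    rfl
  inv_mem' := by
    rintro a ⟨f, hf, haf⟩
    obtain ⟨g, hg, hgf⟩ := hf.symm
    refine ⟨g, hg, fun u => ?_⟩
    have h := hgf _ ((a : MulAut R)⁻¹ u).2
    rw [← haf] at h
    simpa using h.symm

/-- The strongly embedded subgroup is the image of the decomposable automorphisms. If `a` fuses two
elements of `Aut_P(R)` not in `Inn(R)`, then `a⁻¹` extends over an element of `P` outside `R`, so
`hstep` makes it decomposable. -/
theorem essentialWrt_of_not_decomposes [Fact p.Prime] (hS : IsPGroup p S) (hF : F.Saturated p)
    (hP : F.StronglyClosed P) (hR : F.FullyNormalized R) (hRP : R < P) (hc : F.CentricWrt P R)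
    (hstep : ∀ a, F.IsoOn a R R → ∀ z ∈ P, z ∉ R → z ∈ Subgroup.normalizer (R : Set S) →
      ∀ y ∈ Subgroup.normalizer (R : Set S), (∀ u ∈ R, a (z * u * z⁻¹) = y * a u * y⁻¹) →
      F.Decomposes p P a R R)
    {a₀ : S → S} (ha₀ : F.IsoOn a₀ R R) (hna₀ : ¬ F.Decomposes p P a₀ R R) :
    F.EssentialWrt p P R := by
  have hPn := hP.normal
  obtain ⟨T, hT⟩ := hF.exists_sylow hS hR
  refine ⟨hRP, hc, hR, (F.decomposable p P R hRP.le).map (QuotientGroup.mk' _), ?_⟩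
  have hinn : ∀ e : F.Aut R, e ∈ F.inn R ↔ ∃ q ∈ R, ∀ u : R, ((e : MulAut R) u : S) = q * u * q⁻¹ := by
    intro e
    constructor
    · rintro ⟨q, hq⟩
      exact ⟨q, q.2, fun u => congrArg (fun e : MulAut R => (e u : S)) hq.symm⟩
    · rintro ⟨q, hq, h⟩
      exact ⟨⟨q, hq⟩, MulEquiv.ext fun u => Subtype.ext (h u).symm⟩
  -- transport of conjugations by an automorphism
  have htrans : ∀ (e a : F.Aut R) (x y : S) (f : S → S), x ∈ Subgroup.normalizer (R : Set S) →
      (∀ u : R, ((e : MulAut R) u : S) = x * u * x⁻¹) →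
      (∀ u : R, (((a⁻¹ * e * a : F.Aut R) : MulAut R) u : S) = y * u * y⁻¹) →
      (∀ u : R, (((a⁻¹ : F.Aut R) : MulAut R) u : S) = f u) →
      ∀ u ∈ R, f (x * u * x⁻¹) = y * f u * y⁻¹ := by
    intro e a x y f hx he hae hf u hu
    have h := hae (((a⁻¹ : F.Aut R) : MulAut R) ⟨u, hu⟩)
    rw [hf ⟨u, hu⟩] at h
    rw [← h, ← he ⟨u, hu⟩, ← hf]
    simp
  refine isStronglyEmbedded_map_mk T (fun e he => ?_) (fun hle => ?_) ⟨fun e he => ?_, ?_⟩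
    (fun e he => ?_) (fun htop => hna₀ ?_) ?_
  · obtain ⟨q, hq, h⟩ := (hinn e).1 he
    exact (mem_autBy _).2 ⟨q, hRP.le hq, Subgroup.le_normalizer hq, h⟩
  · obtain ⟨z, hzP, hz, hzR⟩ := exists_mem_normalizer_not_mem hS hRP.not_ge
    have hcz : R.normalizerMonoidHom ⟨z, hz⟩ ∈ autBy P R :=
      (mem_autBy _).2 ⟨z, hzP, hz, fun u => rfl⟩
    -- If conjugation by `z` were inner, given by `q`, then `q⁻¹ * z` would centralize `R` and lie
    -- in it by centricity, against `z ∉ R`.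
    obtain ⟨q, hq, h⟩ := (hinn ⟨_, autBy_le_aut _ _ hcz⟩).1 (hle hcz)
    let ι : R →* P := Subgroup.inclusion hRP.le
    have himage : image ι = R := by
      ext u
      exact (mem_image _ _).trans ⟨fun ⟨v, hv⟩ => hv ▸ v.2, fun hu => ⟨⟨u, hu⟩, rfl⟩⟩
    have hle := hc ι (F.conj_mem _ 1 fun x => by simp [ι])
    rw [himage] at hle
    have hqz : q⁻¹ * z ∈ R := by
      have hqP : q⁻¹ ∈ P := inv_mem (hRP.le hq)
      refine hle ⟨P.mul_mem hqP hzP, Subgroup.mem_centralizer_iff.2 fun u hu => ?_⟩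
      have h1 : z * u * z⁻¹ = q * u * q⁻¹ := h ⟨u, hu⟩
      have h2 : z * u = q * u * q⁻¹ * z := by rw [← h1]; group
      rw [mul_assoc q⁻¹, h2]
      group
    exact hzR (by simpa using mul_mem hq hqz)
  · obtain ⟨x, -, hx, h⟩ := (mem_autBy _).1 he
    rw [hT]
    exact (mem_autBy _).2 ⟨x, Subgroup.mem_top x, hx, h⟩
  -- Strong closure of `Aut_P(R)` comes from that of `P`: `a⁻¹` extends over `x`, and the conjugated
  -- automorphism is conjugation by the image of `x`.
  · intro e he a hae
    rw [hT] at hae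
    obtain ⟨x, hxP, hx, hex⟩ := (mem_autBy _).1 he
    obtain ⟨y, -, hy, hay⟩ := (mem_autBy _).1 hae
    obtain ⟨f, hf, haf⟩ := exists_isoOn (a⁻¹).2
    have hxy := htrans e a x y f hx hex hay haf
    obtain ⟨g, U, V, hg, hRU, hgf, hU⟩ := hF.exists_extension hf hR
    have hxU := hU x hx y hy hxy
    refine (mem_autBy _).2 ⟨g x, hg.mem_of_stronglyClosed hP hxU hxP,
      hg.mem_normalizer hf hRU hgf hxU hx, fun u => ?_⟩
    obtain ⟨v, hv, hvu⟩ := hf.surj u.2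
    refine (hay u).trans ?_
    rw [← hvu, ← hxy v hv, ← hgf _ (conj_mem_of_mem_normalizer hx hv), hg.map_conj hxU (hRU hv),
      hgf v hv]
  -- Conjugation by an element of `S` restricts from `P`, which is normal in `S`, so `Aut_S(R)` is
  -- decomposable.
  · rw [hT] at he
    obtain ⟨x, -, hx, hex⟩ := (mem_autBy _).1 he
    refine ⟨_, .single (Or.inr rfl) hRP.le (IsoOn.conj ?_) (IsoOn.conj hx), hex⟩
    rw [Subgroup.normalizer_eq_top]
    exact Subgroup.mem_top x
  · obtain ⟨e, he, hea⟩ := exists_aut ha₀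
    have : (⟨e, he⟩ : F.Aut R) ∈ F.decomposable p P R hRP.le := htop ▸ Subgroup.mem_top _
    obtain ⟨f, hf, hef⟩ := this
    exact hf.congr fun u hu => (hea ⟨u, hu⟩).symm.trans (hef ⟨u, hu⟩)
  · intro e he heN a hae
    obtain ⟨x, hxP, hx, hex⟩ := (mem_autBy _).1 he
    obtain ⟨y, -, hy, hay⟩ := (mem_autBy _).1 hae
    obtain ⟨f, hf, haf⟩ := exists_isoOn (a⁻¹).2
    rw [← inv_mem_iff]
    exact ⟨f, hstep f hf x hxP (fun hxR => heN ((hinn e).2 ⟨x, hxR, hex⟩)) hx y hy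
      (htrans e a x y f hx hex hay haf), haf⟩

/-- Every isomorphism of `F` between subgroups of a strongly closed subgroup `P` is a composite of
restrictions of automorphisms of `P` and of essential subgroups with respect to `P`. -/
theorem Saturated.decomposes [Fact p.Prime] (hS : IsPGroup p S) (hF : F.Saturated p)
    (hP : F.StronglyClosed P) {f : S → S} (hQ : Q ≤ P) (hf : F.IsoOn f Q R) :
    F.Decomposes p P f Q R := by
  have hPn := hP.normal
  induction hn : Nat.card P - Nat.card Q using Nat.strong_induction_on generalizing Q R f with
  | _ n ih =>
  subst hn
  by_cases hQP : Q = P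
  · subst hQP
    have hR : R = Q := Subgroup.eq_of_le_of_card_ge (hf.le_of_le hP le_rfl) hf.card_eq.le
    subst hR
    exact .single (Or.inr rfl) le_rfl hf hf
  have hcard : Nat.card Q < Nat.card P :=
    lt_of_not_ge fun h => hQP (Subgroup.eq_of_le_of_card_ge hQ h)
  replace ih : ∀ (Q' R' : Subgroup S) (f : S → S), Nat.card Q < Nat.card Q' → Q' ≤ P →
      F.IsoOn f Q' R' → F.Decomposes p P f Q' R' :=
    fun Q' R' f hlt hQ' hf => ih _ (by omega) hQ' hf rfl
  obtain ⟨τ, M, hτ, hM⟩ := F.exists_fullyNormalized Q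
  have hMP : M ≤ P := hτ.le_of_le hP hQ
  rw [hτ.card_eq] at hcard ih
  have hMlt : M < P := lt_of_le_of_ne hMP fun h => by simp [h] at hcard
  have hstep : ∀ a, F.IsoOn a M M → ∀ z ∈ P, z ∉ M → z ∈ Subgroup.normalizer (M : Set S) →
      ∀ y ∈ Subgroup.normalizer (M : Set S), (∀ u ∈ M, a (z * u * z⁻¹) = y * a u * y⁻¹) →
      F.Decomposes p P a M M := by
    intro a ha z hzP hzM hz y hy hzy
    obtain ⟨g, U, V, hg, hMU, hga, hU⟩ := hF.exists_extension ha hM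
    exact decomposes_of_extension ih hg hMU hMP (hU z hz y hy hzy) hzP hzM ha hga
  have haut : ∀ a, F.IsoOn a M M → F.Decomposes p P a M M := by
    intro a ha
    by_cases hc : F.CentricWrt P M
    · by_contra hna
      exact hna (.single (Or.inl (essentialWrt_of_not_decomposes hS hF hP hM hMlt hc hstep ha hna))
        le_rfl ha ha)
    · obtain ⟨z, hzP, hzM, hz⟩ := exists_mem_centralizing hF hP hM hc
      refine hstep a ha z hzP hzM (mem_normalizer_of_conj_mem fun u hu => (hz u hu).symm ▸ hu) 1
        (one_mem _) fun u hu => ?_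
      rw [hz u hu]
      simp
  -- After correction by `a`, `k` extends to `N_S(Q')`, which meets `P` outside `Q'`; `a` itself
  -- decomposes by `haut` and is then undone.
  have hiso : ∀ (Q' : Subgroup S) (k : S → S), Q' ≤ P → F.IsoOn k Q' M →
      F.Decomposes p P k Q' M := by
    intro Q' k hQ' hk
    obtain ⟨a, g, V, ha, hg, hgk⟩ := hF.exists_extension_normalizer hS hM hk
    obtain ⟨x, hxP, hx, hxQ⟩ := exists_mem_normalizer_not_mem hS (P := P) (R := Q') fun hle => by
      rw [← hk.card_eq, hQ'.antisymm hle] at hcard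
      exact lt_irrefl _ hcard
    have h1 := decomposes_of_extension (hk.card_eq.symm ▸ ih) hg Subgroup.le_normalizer hQ' hx hxP
      hxQ (hk.trans ha) hgk
    obtain ⟨b, hb, hba⟩ := (haut a ha).symm
    exact (h1.trans hb).congr fun u hu => (hba _ (hk.mem hu)).symm
  obtain ⟨f', hf', hff', -⟩ := hf.symm
  -- `f` is `τ : Q → M` followed by the inverse of `τ ∘ f⁻¹ : R → M`.
  obtain ⟨σ, hσ, hστ⟩ := (hiso R _ (hf.le_of_le hP hQ) (hf'.trans hτ)).symm
  refine ((hiso Q τ hQ hτ).trans hσ).congr fun x hx => ?_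
  have := hστ _ (hf.mem hx)
  rw [hff' x hx] at this
  exact this.symm

end FusionSystem

end Fusion

/-! ### Normality of `P` in `F` -/

namespace Fusion

namespace FusionSystem

variable {S : Type*} [Group S]

variable {F : FusionSystem S} {p : ℕ} {P Q R T : Subgroup S} {f g : S → S}

/-- `f` extends to an isomorphism `PQ → PR` of `F`. -/
def ExtendsOver (F : FusionSystem S) (P : Subgroup S) (f : S → S) (Q R : Subgroup S) : Prop :=
  ∃ g, F.IsoOn g (P ⊔ Q) (P ⊔ R) ∧ ∀ u ∈ Q, g u = f u

theorem IsoOn.self_of_stronglyClosed [Finite S] (hP : F.StronglyClosed P) (hg : F.IsoOn g Q R) (hPQ : P ≤ Q) :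
    F.IsoOn g P P :=
  hg.exists_eq_self hPQ fun _ hx => hg.mem_of_stronglyClosed hP (hPQ hx) hx

theorem ExtendsOver.of_isoOn [Finite S] {V : Subgroup S} (hP : F.StronglyClosed P)
    (hg : F.IsoOn g (P ⊔ Q) V) (hf : F.IsoOn f Q R) (hgf : ∀ u ∈ Q, g u = f u) :
    F.ExtendsOver P f Q R := by
  have hPn := hP.normal
  have hgP := hg.self_of_stronglyClosed hP le_sup_left
  refine ⟨g, hg.restrict le_rfl (fun x hx => ?_) fun y hy => ?_, hgf⟩
  · obtain ⟨y, hy, z, hz, rfl⟩ := Subgroup.mem_sup_of_normal_left.1 hx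
    rw [hg.map_mul (le_sup_left (a := P) hy) (le_sup_right (a := P) hz), hgf z hz]
    exact mul_mem (le_sup_left (a := P) (hgP.mem hy)) (le_sup_right (a := P) (hf.mem hz))
  · obtain ⟨v, hv, w, hw, rfl⟩ := Subgroup.mem_sup_of_normal_left.1 hy
    obtain ⟨y, hyP, rfl⟩ := hgP.surj hv
    obtain ⟨z, hz, rfl⟩ := hf.surj hw
    refine ⟨y * z, mul_mem (le_sup_left (a := P) hyP) (le_sup_right (a := P) hz), ?_⟩
    rw [hg.map_mul (le_sup_left (a := P) hyP) (le_sup_right (a := P) hz), hgf z hz]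

theorem ExtendsOver.trans (hf : F.ExtendsOver P f Q R) (hfi : F.IsoOn f Q R)
    (hg : F.ExtendsOver P g R T) : F.ExtendsOver P (fun x => g (f x)) Q T := by
  obtain ⟨f', hf', hff'⟩ := hf
  obtain ⟨g', hg', hgg'⟩ := hg
  exact ⟨_, hf'.trans hg', fun u hu => by rw [hff' u hu, hgg' _ (hfi.mem hu)]⟩

theorem ExtendsOver.congr (hf : F.ExtendsOver P f Q R) (h : ∀ x ∈ Q, g x = f x) :
    F.ExtendsOver P g Q R := by
  obtain ⟨f', hf', hff'⟩ := hf
  exact ⟨f', hf', fun u hu => (hff' u hu).trans (h u hu).symm⟩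

theorem ExtendsOver.symm (hf : F.ExtendsOver P f Q R) (hfi : F.IsoOn f Q R)
    (hgf : ∀ x ∈ Q, g (f x) = x) : F.ExtendsOver P g R Q := by
  obtain ⟨f', hf', hff'⟩ := hf
  obtain ⟨g', hg', hgg', -⟩ := hf'.symm
  refine ⟨g', hg', fun v hv => ?_⟩
  obtain ⟨u, hu, rfl⟩ := hfi.surj hv
  rw [hgf u hu, ← hff' u hu, hgg' u (le_sup_right (a := P) hu)]

/-- The `F`-automorphisms of `R` that centralize `R / (P ∩ R)` and act on `P ∩ R` as elements of `P`. -/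
def inducedOnInf (F : FusionSystem S) (P R : Subgroup S) : Subgroup (F.Aut R) where
  carrier := {e | (∃ x ∈ P, ∀ u : R, (u : S) ∈ P → ((e : MulAut R) u : S) = x * u * x⁻¹) ∧
    ∀ u : R, ((e : MulAut R) u : S) * (u : S)⁻¹ ∈ P}
  one_mem' := ⟨⟨1, one_mem _, fun u _ => by simp⟩, fun u => by simp⟩
  mul_mem' := by
    rintro a b ⟨⟨x, hx, hax⟩, ha⟩ ⟨⟨y, hy, hby⟩, hb⟩
    refine ⟨⟨x * y, mul_mem hx hy, fun u hu => ?_⟩, fun u => ?_⟩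
    · have hbu : ((b : MulAut R) u : S) ∈ P := by simpa using mul_mem (hb u) hu
      have := hax _ hbu
      rw [hby u hu] at this
      simpa [mul_assoc] using this
    · have := mul_mem (ha ((b : MulAut R) u)) (hb u)
      simpa [mul_assoc] using this
  inv_mem' := by
    rintro a ⟨⟨x, hx, hax⟩, ha⟩
    have ha' : ∀ u : R, (u : S) * (((a : MulAut R)⁻¹ u : R) : S)⁻¹ ∈ P := fun u => by
      simpa using ha ((a : MulAut R)⁻¹ u)
    refine ⟨⟨x⁻¹, inv_mem hx, fun u hu => ?_⟩, fun u => ?_⟩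
    · have hm : (((a : MulAut R)⁻¹ u : R) : S) ∈ P := by
        simpa using mul_mem (inv_mem (ha' u)) hu
      have := hax _ hm
      simp only [MulAut.apply_inv_self] at this
      rw [this]
      simp [mul_assoc]
    · simpa using inv_mem (ha' u)

/-- A suitable `q`-power `d` of the automorphism is trivial on both `P ∩ R` and `R / (P ∩ R)`. Then
`d ^ n` sends `u` to `(d u * u⁻¹) ^ n * u`, so the exponent of `R` kills `d`. -/
theorem isPGroup_inducedOnInf [Finite S] {q : ℕ} (hS : IsPGroup q S) : IsPGroup q (F.inducedOnInf P R) := by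
  rintro ⟨e, ⟨x, hx, hex⟩, he⟩
  obtain ⟨k, hk⟩ := hS x
  have hmem : ∀ u : R, (u : S) ∈ P → ((e : MulAut R) u : S) ∈ P := fun u hu => by
    simpa using mul_mem (he u) hu
  -- powers of `e` on `P ∩ R`
  have hpow : ∀ n : ℕ, ∀ u : R, (u : S) ∈ P →
      (((e : MulAut R) ^ n) u : S) = x ^ n * u * (x ^ n)⁻¹ := by
    intro n
    induction n with
    | zero => intro u _; simp
    | succ n ih =>
      intro u hu
      rw [pow_succ, MulAut.mul_apply, ih _ (hmem u hu), hex u hu, pow_succ]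
      group
  have hquot : ∀ n : ℕ, ∀ u : R, (((e : MulAut R) ^ n) u : S) * (u : S)⁻¹ ∈ P := by
    intro n
    induction n with
    | zero => intro u; simp
    | succ n ih =>
      intro u
      have := mul_mem (ih ((e : MulAut R) u)) (he u)
      rw [pow_succ, MulAut.mul_apply]
      simpa [mul_assoc] using this
  set d := (e : MulAut R) ^ q ^ k with hd
  have hdfix : ∀ u : R, (u : S) ∈ P → d u = u := fun u hu =>
    Subtype.ext (by rw [hd, hpow _ u hu, hk]; simp)
  have hdpow : ∀ n : ℕ, ∀ u : R, (d ^ n) u = (d u * u⁻¹) ^ n * u := by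
    intro n u
    induction n with
    | zero => simp
    | succ n ih =>
      have hfix : d ((d u * u⁻¹) ^ n) = (d u * u⁻¹) ^ n :=
        hdfix _ (by simpa using pow_mem (hquot (q ^ k) u) n)
      rw [pow_succ', MulAut.mul_apply, ih, map_mul, hfix, pow_succ]
      group
  obtain ⟨m, hm⟩ : ∃ m : ℕ, ∀ t : R, t ^ q ^ m = 1 := by
    choose m hm using hS.to_subgroup R
    have := Fintype.ofFinite R
    refine ⟨∑ t, m t, fun t => ?_⟩
    rw [← orderOf_dvd_iff_pow_eq_one]
    exact (orderOf_dvd_of_pow_eq_one (hm t)).trans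
      (pow_dvd_pow q (Finset.single_le_sum (fun _ _ => Nat.zero_le _) (Finset.mem_univ t)))
  refine ⟨k + m, Subtype.ext (Subtype.ext (MulEquiv.ext fun u => ?_))⟩
  have := hdpow (q ^ m) u
  rw [hm, one_mul, hd, ← pow_mul, ← pow_add] at this
  exact this

/-- An automorphism `a` of `R` agrees on `P ∩ R` with some automorphism `b` of `P`, so conjugation
by `x` there turns into conjugation by `b x`. -/
theorem inducedOnInf_normal [Finite S] (hP : F.StronglyClosed P)
    (hext : ∀ (Q R : Subgroup S) (f : S → S), Q ≤ P → F.IsoOn f Q R →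
      ∃ b, F.IsoOn b P P ∧ ∀ u ∈ Q, b u = f u) : (F.inducedOnInf P R).Normal := by
  refine ⟨fun e => ?_⟩
  rintro ⟨⟨x, hx, hex⟩, he⟩ a
  obtain ⟨f, hf, haf⟩ := exists_isoOn a.2
  obtain ⟨f', hf', haf'⟩ := exists_isoOn (a⁻¹).2
  obtain ⟨X, -, hfX⟩ := hf.exists_restrict (inf_le_right : P ⊓ R ≤ R)
  obtain ⟨b, hb, hbf⟩ := hext _ _ f inf_le_left hfX
  refine ⟨⟨b x, hb.mem hx, fun u hu => ?_⟩, fun u => ?_⟩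
  · obtain ⟨v, hvR, hvu⟩ := hf.surj u.2
    have hav : (a : MulAut R) ⟨v, hvR⟩ = u := Subtype.ext ((haf _).trans hvu)
    have hv : ((a : MulAut R)⁻¹ u : R) = ⟨v, hvR⟩ := by rw [← hav]; simp
    have hvP : v ∈ P := by
      have := hf'.mem_of_stronglyClosed hP u.2 hu
      rwa [← haf' u, InvMemClass.coe_inv, hv] at this
    have hev : ((e : MulAut R) ⟨v, hvR⟩ : S) ∈ P ⊓ R :=
      ⟨by simpa using mul_mem (he ⟨v, hvR⟩) hvP, Subtype.prop _⟩
    calc (((a * e * a⁻¹ : F.Aut R) : MulAut R) u : S)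
        = (a : MulAut R) ((e : MulAut R) ((a : MulAut R)⁻¹ u)) := rfl
      _ = b x * u * (b x)⁻¹ := by
        rw [hv, haf, ← hbf _ hev, hex _ hvP, hb.map_conj hx hvP, hbf v ⟨hvP, hvR⟩, hvu]
  · have h1 := hf.mem_of_stronglyClosed hP
      ((e : MulAut R) ((a : MulAut R)⁻¹ u) * ((a : MulAut R)⁻¹ u)⁻¹).2 (he ((a : MulAut R)⁻¹ u))
    rw [← haf] at h1
    simpa using h1

/-- If all isomorphisms between subgroups of `P` extend to `P`, then all isomorphisms `Q → R` of `F`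
extend to `PQ → PR`. -/
theorem Saturated.extendsOver [Finite S] [Fact p.Prime] (hS : IsPGroup p S) (hF : F.Saturated p)
    (hP : F.StronglyClosed P)
    (hext : ∀ (Q R : Subgroup S) (f : S → S), Q ≤ P → F.IsoOn f Q R →
      ∃ b, F.IsoOn b P P ∧ ∀ u ∈ Q, b u = f u)
    (hf : F.IsoOn f Q R) : F.ExtendsOver P f Q R := by
  have hPn := hP.normal
  induction hn : Nat.card S - Nat.card Q using Nat.strong_induction_on generalizing Q R f with
  | _ n ih =>
  subst hn
  by_cases hPQ : P ≤ Q
  · exact .of_isoOn hP (sup_eq_right.2 hPQ ▸ hf) hf fun _ _ => rfl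
  -- Any proper extension suffices: by induction it extends to `PU`, which contains `PQ'`.
  have hbig : ∀ {Q' R' U V : Subgroup S} {k g : S → S} {x : S}, Nat.card Q' = Nat.card Q →
      F.IsoOn k Q' R' → F.IsoOn g U V → Q' ≤ U → (∀ u ∈ Q', g u = k u) → x ∈ U → x ∉ Q' →
      F.ExtendsOver P k Q' R' := by
    intro Q' R' U V k g x hcard hk hg hQU hgk hxU hxQ
    have hlt : Nat.card Q' < Nat.card U :=
      lt_of_not_ge fun hle => hxQ (Subgroup.eq_of_le_of_card_ge hQU hle ▸ hxU)
    obtain ⟨g', hg', hgg'⟩ := ih _ (by have := U.card_le_card_group; omega) hg rfl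
    obtain ⟨W, -, hW⟩ := hg'.exists_restrict (sup_le_sup_left hQU P)
    exact .of_isoOn hP hW hk fun u hu => (hgg' u (hQU hu)).trans (hgk u hu)
  have hnle : ∀ {Q' : Subgroup S} {k : S → S}, F.IsoOn k Q Q' → ¬ P ≤ Q' := by
    intro Q' k hk hle
    obtain ⟨k', hk', -, -⟩ := hk.symm
    refine hPQ fun y hy => ?_
    obtain ⟨x, hx, rfl⟩ := (hk'.self_of_stronglyClosed hP hle).surj hy
    exact hk'.mem (hle hx)
  obtain ⟨τ, M, hτ, hM⟩ := F.exists_fullyNormalized Q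
  have haut : ∀ a, F.IsoOn a M M → F.ExtendsOver P a M M := by
    intro a ha
    obtain ⟨x, hxP, hx, hxM⟩ := exists_mem_normalizer_not_mem hS (hnle hτ)
    obtain ⟨g, U, V, hg, hMU, hga, hU⟩ := hF.exists_extension ha hM
    refine hbig hτ.card_eq.symm ha hg hMU hga ?_ hxM
    obtain ⟨T, hT⟩ := hF.exists_sylow hS hM
    have hnormal := inducedOnInf_normal (R := M) hP hext
    -- A normal `p`-subgroup lies in the Sylow subgroup `Aut_S(M)`. So the conjugate under `a` of
    -- conjugation by `x` is again induced by `S`, and `a` extends over `x`.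
    have hle := (isPGroup_inducedOnInf (F := F) (P := P) (R := M) hS).le_sylow_of_normal T
    obtain ⟨α, hα, hαa⟩ := exists_aut ha
    have hcx : M.normalizerMonoidHom ⟨x, hx⟩ ∈ autBy P M := (mem_autBy _).2 ⟨x, hxP, hx, fun u => rfl⟩
    have hmem : (⟨_, autBy_le_aut _ _ hcx⟩ : F.Aut M) ∈ F.inducedOnInf P M := by
      refine ⟨⟨x, hxP, fun u _ => rfl⟩, fun u => ?_⟩
      have := mul_mem hxP (hPn.conj_mem _ (inv_mem hxP) u)
      simpa [mul_assoc] using this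
    have h1 := hle (hnormal.conj_mem _ hmem ⟨α, hα⟩)
    rw [hT] at h1
    obtain ⟨y, -, hy, h⟩ := (mem_autBy _).1 h1
    refine hU x hx y hy fun u hu => ?_
    have h2 := h (α ⟨u, hu⟩)
    rw [hαa ⟨u, hu⟩] at h2
    rw [← h2, ← hαa ⟨_, conj_mem_of_mem_normalizer hx hu⟩]
    simp
    rfl
  have hiso : ∀ (Q' : Subgroup S) (k : S → S), ¬ P ≤ Q' → F.IsoOn k Q' M →
      F.ExtendsOver P k Q' M := by
    intro Q' k hPQ' hk
    obtain ⟨a, g, V, ha, hg, hgk⟩ := hF.exists_extension_normalizer hS hM hk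
    obtain ⟨x, hxP, hx, hxQ⟩ := exists_mem_normalizer_not_mem hS hPQ'
    have h1 := hbig (hk.card_eq.trans hτ.card_eq.symm) (hk.trans ha) hg Subgroup.le_normalizer hgk
      hx hxQ
    obtain ⟨b, hb, hba, -⟩ := ha.symm
    exact (h1.trans (hk.trans ha) ((haut a ha).symm ha hba)).congr
      fun u hu => (hba _ (hk.mem hu)).symm
  obtain ⟨f', hf', hff', -⟩ := hf.symm
  have hRM := hf'.trans hτ
  obtain ⟨σ, hσ, hστ, -⟩ := hRM.symm
  have h2 := (hiso R _ (hnle hf) hRM).symm hRM hστ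
  refine ((hiso Q τ hPQ hτ).trans hτ h2).congr fun x hx => ?_
  have := hστ _ (hf.mem hx)
  rw [hff' x hx] at this
  exact this.symm

theorem Decomposes.exists_extension (hE : ∀ Q, ¬ F.EssentialWrt p P Q)
    (hf : F.Decomposes p P f Q R) : ∃ b, F.IsoOn b P P ∧ ∀ u ∈ Q, b u = f u := by
  induction hf with
  | nil hQ hf => exact ⟨_, IsoOn.refl P, fun u hu => (hf u hu).symm⟩
  | cons hT hQ hg hgQ hf hh ih =>
    obtain rfl := hT.resolve_left (hE _)
    obtain ⟨b, hb, hbf⟩ := ih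
    exact ⟨_, hg.trans hb, fun u hu => by rw [hbf _ (hgQ.mem hu), hh u hu]⟩

theorem isNormal_of_extendsOver [Finite S] (hP : F.StronglyClosed P)
    (h : ∀ (Q R : Subgroup S) (f : S → S), F.IsoOn f Q R → F.ExtendsOver P f Q R) :
    F.IsNormal P := by
  refine ⟨hP.normal, fun Q R φ hφ => ?_⟩
  obtain ⟨f, hf, hφf⟩ := IsoOn.exists_of_hom hφ
  obtain ⟨g, hg, hgf⟩ := h _ _ f hf
  have hle : image φ ≤ R := fun y hy => by
    obtain ⟨u, rfl⟩ := (mem_image φ y).1 hy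
    exact (φ u).2
  obtain ⟨ψ, hψ, hψg⟩ := hg.exists_hom (sup_le_sup_left hle P)
  refine ⟨ψ, hψ, fun u => ?_, ?_⟩
  · rw [hψg, hφf]
    exact hgf u u.2
  · have hgP := hg.self_of_stronglyClosed hP le_sup_left
    ext y
    rw [mem_image]
    constructor
    · rintro ⟨u, rfl⟩
      exact (hψg _).symm ▸ hgP.mem u.2
    · intro hy
      obtain ⟨x, hx, rfl⟩ := hgP.surj hy
      exact ⟨⟨x, hx⟩, hψg _⟩

/-- Extending an automorphism `a` of `Q` to `PQ` turns conjugation by `x` in `P` into conjugation by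
the image of `x`, again in `P`. So `Out_P(Q)` is normal, and a strongly embedded `H` would contain
it together with all its conjugates, hence so would every `H ∩ H^g`. -/
theorem IsNormal.not_essentialWrt [Finite S] (hP : F.IsNormal P) : ¬ F.EssentialWrt p P Q := by
  rintro ⟨hQP, -, -, H, hH⟩
  obtain ⟨x, hx⟩ := hH.conj_le
  have hnormal : (F.outBy P Q).Normal := by
    refine Subgroup.Normal.map ⟨fun e he a => ?_⟩ _ (QuotientGroup.mk'_surjective _)
    obtain ⟨x, hxP, hxQ, hex⟩ := (mem_autBy _).1 he
    obtain ⟨ψ, hψ, hψa, hψP⟩ := hP.2 Q Q _ a.2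
    have hψx : (ψ (Subgroup.inclusion le_sup_left ⟨x, hxP⟩) : S) ∈ P := by
      have := coe_mem_image (ψ.comp (Subgroup.inclusion (le_sup_left : P ≤ P ⊔ Q))) ⟨x, hxP⟩
      rwa [hψP] at this
    have key : ∀ u : Q, (((a * e * a⁻¹ : F.Aut Q) : MulAut Q) u : S) =
        (ψ (Subgroup.inclusion le_sup_left ⟨x, hxP⟩) : S) * u *
          (ψ (Subgroup.inclusion le_sup_left ⟨x, hxP⟩) : S)⁻¹ := by
      intro u
      set v := (a : MulAut Q)⁻¹ u with hv
      have hav : (a : MulAut Q) v = u := by simp [hv]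
      have h1 : ∀ w : Q, (ψ (Subgroup.inclusion le_sup_right w) : S) = (a : MulAut Q) w := hψa
      calc (((a * e * a⁻¹ : F.Aut Q) : MulAut Q) u : S)
          = (a : MulAut Q) ((e : MulAut Q) v) := rfl
        _ = ψ (Subgroup.inclusion le_sup_right ((e : MulAut Q) v)) := (h1 _).symm
        _ = ψ (Subgroup.inclusion le_sup_left ⟨x, hxP⟩ * Subgroup.inclusion le_sup_right v *
              (Subgroup.inclusion le_sup_left ⟨x, hxP⟩)⁻¹) := by
          congr 2
          exact Subtype.ext (hex v)
        _ = _ := by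
          rw [map_mul, map_mul, map_inv]
          push_cast
          rw [h1, hav]
    exact (mem_autBy _).2 ⟨_, hψx, mem_normalizer_of_conj_mem fun u hu => by
      rw [← key ⟨u, hu⟩]
      exact Subtype.prop _, key⟩
  have hconj : ∀ y, conjSubgroup (F.outBy P Q) y ≤ F.outBy P Q := fun y d hd => by
    simpa [mul_assoc] using hnormal.conj_mem _ (mem_conjSubgroup.1 hd) y⁻¹
  have hle : F.outBy P Q ≤ H := fun d hd =>
    hx (mem_conjSubgroup.2 (hnormal.conj_mem d hd x))
  obtain ⟨g, -, hg⟩ := SetLike.exists_of_lt (lt_top_iff_ne_top.2 hH.proper)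
  exact hH.not_conj_le g hg _ le_rfl hH.nontrivial 1 fun d hd =>
    ⟨hle (hconj 1 hd), mem_conjSubgroup.2 (hle (hnormal.conj_mem _ (hconj 1 hd) g))⟩

end FusionSystem

end Fusion

theorem theoremA {p : ℕ} [Fact p.Prime] {S : Type*} [Group S] [Finite S] (hS : IsPGroup p S)
    (F : Fusion.FusionSystem S) (hF : F.Saturated p)
    (P : Subgroup S) (hP : F.StronglyClosed P) :
    (∀ (Q R : Subgroup S), Q ≤ P → R ≤ P →
      ∀ ψ : Q ≃* R, ψ.toMonoidHom ∈ F.Hom Q R →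
      ∃ (n : ℕ) (Qs : Fin (n + 1) → Subgroup S) (Ss : Fin n → Subgroup S)
        (ψs : ∀ i : Fin n, MulAut (Ss i)),
        Qs 0 = Q ∧ Qs (Fin.last n) = R ∧
        (∀ i, Qs i ≤ P ∧ Nonempty (Q ≃* Qs i)) ∧
        (∀ i, F.EssentialWrt p P (Ss i) ∨ Ss i = P) ∧
        (∀ i, Qs i.castSucc ≤ Ss i ∧ Qs i.succ ≤ Ss i) ∧
        (∀ i, ψs i ∈ F.Aut (Ss i)) ∧
        (∀ i, ((Qs i.castSucc).subgroupOf (Ss i)).map (ψs i).toMonoidHom =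
          (Qs i.succ).subgroupOf (Ss i)) ∧
        -- `ψ` is the composite of the restrictions of `ψs 0`, then `ψs 1`, ..., then `ψs (n - 1)`
        (∀ x : Q, ∃ y : Fin (n + 1) → S,
          y 0 = x ∧ y (Fin.last n) = ψ x ∧
          ∀ i : Fin n, ∃ h : y i.castSucc ∈ Ss i, (ψs i ⟨y i.castSucc, h⟩ : S) = y i.succ)) ∧
    (F.IsNormal P ↔ ¬ ∃ Q : Subgroup S, F.EssentialWrt p P Q) := by
  refine ⟨fun Q R hQ _ ψ hψ => ?_, fun hN ⟨Q, hQ⟩ => hN.not_essentialWrt hQ, fun hE => ?_⟩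
  · obtain ⟨f, hf, hψf⟩ := Fusion.FusionSystem.exists_isoOn_equiv hψ
    exact (hF.decomposes hS hP hQ hf).exists_fin_sequence hψf
  · exact Fusion.FusionSystem.isNormal_of_extendsOver hP fun Q R f hf =>
      hF.extendsOver hS hP (fun Q R f hQ hf =>
        (hF.decomposes hS hP hQ hf).exists_extension fun Q hQ => hE ⟨Q, hQ⟩) hf
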